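/- Let $n\ge 3$ and $k>0$. Identify $\mathbb R^2$ with $\mathbb C$, with inner product $\langle z,w\rangle=\mathrm{Re}(\bar z w)$, and let $\alpha_l=-ie^{i\pi l/n}$, $1\le l\le n$, be the positive roots of the dihedral group $\mathcal D_2(n)$ (of order $2n$), with reflections $\sigma_{\alpha}x=x-2\langle\alpha,x\rangle\alpha$. The Dunkl operators with constant multiplicity $k$ are $$T_\xi f(x)=\partial_\xi f(x)+k\sum_{l=1}^n\langle\alpha_l,\xi\rangle\frac{f(x)-f(\sigma_{\alpha_l}x)}{\langle\alpha_l,x\rangle}$$ (the quotient being extended by continuity to $\langle\alpha_l,x\rangle=0$). The Dunkl kernel $E_k(\cdot,y)$ is the unique real-analytic function on $\mathbb R^2$ with $T_\xi E_k(\cdot,y)=\langle\xi,y\rangle E_k(\cdot,y)$ for all $\xi$ and $E_k(0,y)=1$, and the generalized Bessel function is $D_k^{\mathcal D_2(n)}(x,y)=\frac1{2n}\sum_{w\in\mathcal D_2(n)}E_k(wx,y)$. Let $x=\rho e^{i\phi}$ and $y=re^{i\theta}$ with $\rho,r\ge 0$ and $\phi,\theta\in[0,\pi/n]$. Put $b_s^{\theta,n}=\cos(\theta+2\pi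 s/n)$, $B(u,v)=\Gamma(u)\Gamma(v)/\Gamma(u+v)$, $${}_0F_{n-1}(a_1,\dots,a_{n-1};z)=\sum_{j\ge0}\frac{1}{(a_1)_j\cdots(a_{n-1})_j}\frac{z^j}{j!},$$ $$\Sigma_n=\{(u_1,\dots,u_{n-1})\in\mathbb R^{n-1}: u_1,\dots,u_{n-1}\ge0,\ u_0:=1-u_1-\cdots-u_{n-1}\ge0\},$$ and let $c_{n,k}=B(k+\tfrac12,\tfrac12)\,\Gamma(nk+1)/k$. Then $$D_k^{\mathcal D_2(n)}(x,y)=\frac{c_{n,k}}{nB(k+\frac12,\frac12)\Gamma(k)^n}\int_{\Sigma_n}\exp\Bigl(\rho r\Bigl(u_0\cos(\theta-\phi)+\sum_{s=1}^{n-1}u_sb_s^{\theta-\phi,n}\Bigr)\Bigr)\;{}_0F_{n-1}\Bigl(2k,\underbrace{k,\dots,k}_{n-2};-4\Bigl(\frac{\rho r}2\Bigr)^nu_0u_1\cdots u_{n-1}\sin(n\theta)\sin(n\phi)\Bigr)\,u_0^{k-1}\prod_{s=1}^{n-1}u_s^{k-1}\,du_1\cdots du_{n-1},$$ the integral being absolutely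 convergent. (The constant in front of the integral equals $\Gamma(nk)/\Gamma(k)^n$.) -/

import Mathlib

/-! The plane `ℝ²` is `ℂ` with its real inner product `inner ℝ z w = Re (conj z * w)`. -/

noncomputable section

namespace Dihedral

/-- The positive roots `-i e^{iπl/n}`, `l = 1, …, n`, of the dihedral root system `I₂(n)`
(here `l = j + 1`). They are unit vectors. -/
def root (n : ℕ) (j : Fin n) : ℂ :=
  -Complex.I * Complex.exp (((Real.pi * ((j : ℕ) + 1 : ℝ) / n : ℝ) : ℂ) * Complex.I)

/-- The orthogonal reflection of the plane in the line orthogonal to the unit vector `α`. -/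
def reflect (α x : ℂ) : ℂ := x - ((2 * inner ℝ α x : ℝ) : ℂ) * α

/-- The rotation of the plane through the angle `2πj/n`. -/
def rotate (n : ℕ) (j : Fin n) (x : ℂ) : ℂ :=
  Complex.exp (((2 * Real.pi * (j : ℕ) / n : ℝ) : ℂ) * Complex.I) * x

open Classical in
/-- The difference quotient `(f x - f (σ_α x)) / ⟨α, x⟩` for a unit vector `α`, extended to the
line `⟨α, x⟩ = 0` by its limit (for differentiable `f`), which is `2 ∂_α f (x)`. -/
def diffQuot (f : ℂ → ℝ) (α x : ℂ) : ℝ :=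
  if inner ℝ α x = 0 then 2 * fderiv ℝ f x α else (f x - f (reflect α x)) / inner ℝ α x

/-- The Dunkl operator `T_ξ` of `I₂(n)` with constant multiplicity `k`:
`T_ξ f (x) = ∂_ξ f (x) + k ∑_{α > 0} ⟨α, ξ⟩ (f x - f (σ_α x)) / ⟨α, x⟩`. -/
def dunklOp (n : ℕ) (k : ℝ) (ξ : ℂ) (f : ℂ → ℝ) (x : ℂ) : ℝ :=
  fderiv ℝ f x ξ + k * ∑ j : Fin n, inner ℝ (root n j) ξ * diffQuot f (root n j) x

/-- `f` is a real-analytic joint eigenfunction of the Dunkl operators, `T_ξ f = ⟨ξ, y⟩ f` for all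
`ξ`, normalized by `f 0 = 1`. -/
structure IsDunklEigenfunction (n : ℕ) (k : ℝ) (y : ℂ) (f : ℂ → ℝ) : Prop where
  analytic : AnalyticOnNhd ℝ f Set.univ
  map_zero : f 0 = 1
  eigen : ∀ ξ x : ℂ, dunklOp n k ξ f x = inner ℝ ξ y * f x

/-- The Dunkl kernel `x ↦ E_k(x, y)`: the (unique) normalized real-analytic joint eigenfunction of
the Dunkl operators. -/
def dunklKernel (n : ℕ) (k : ℝ) (y : ℂ) : ℂ → ℝ :=
  Classical.epsilon (IsDunklEigenfunction n k y)

/-- The generalized Bessel function of the dihedral group of order `2n` with constant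
multiplicity `k`: the average `(1 / 2n) ∑_w E_k(w x, y)` of the Dunkl kernel over the group, which
consists of `n` rotations and `n` reflections. -/
def generalizedBessel (n : ℕ) (k : ℝ) (x y : ℂ) : ℝ :=
  (1 / (2 * n : ℝ)) *
    ∑ j : Fin n, (dunklKernel n k y (rotate n j x) + dunklKernel n k y (reflect (root n j) x))

/-- The Beta function. -/
def beta (u v : ℝ) : ℝ := Real.Gamma u * Real.Gamma v / Real.Gamma (u + v)

/-- The constant `c_{n,k}` in the expansion of the generalized Bessel function
`(c_{n,k} / B(k+1/2, 1/2)) (2/(ρr))^{nk} ∑_j I_{nj+nk}(ρr) (j+k) C_j(cos nφ) C_j(cos nθ) / C_j(1)`,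
`C_j = C_j^{(k)}` the Gegenbauer polynomials, subject to the value `1` at `ρ = 0`. Since
`(2/v)^{nk} I_{nj+nk}(v)` tends to `1 / Γ(nk+1)` for `j = 0` and to `0` for `j ≥ 1` as `v → 0`, the
requirement is `(c_{n,k} / B(k+1/2, 1/2)) * k / Γ(nk+1) = 1`; see `normConst_spec`. -/
def normConst (n : ℕ) (k : ℝ) : ℝ :=
  beta (k + 1 / 2) (1 / 2) * Real.Gamma (n * k + 1) / k

theorem normConst_spec (n : ℕ) {k : ℝ} (hk : 0 < k) :
    normConst n k / beta (k + 1 / 2) (1 / 2) * (k / Real.Gamma (n * k + 1)) = 1 := by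
  have h1 : 0 < beta (k + 1 / 2) (1 / 2) :=
    div_pos (mul_pos (Real.Gamma_pos_of_pos (by linarith)) (Real.Gamma_pos_of_pos (by norm_num)))
      (Real.Gamma_pos_of_pos (by linarith))
  have h2 : 0 < Real.Gamma (n * k + 1) := Real.Gamma_pos_of_pos (by positivity)
  unfold normConst
  have h3 := h1.ne'
  generalize beta (k + 1 / 2) (1 / 2) = B at h3 ⊢
  field_simp

/-- `b_s^{θ,n} = cos (θ + 2πs/n)`. -/
def b (n : ℕ) (θ : ℝ) (s : ℕ) : ℝ := Real.cos (θ + 2 * Real.pi * s / n)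

/-- The hypergeometric function `₀F_m(a₁, …, a_m; z) = ∑_j z^j / ((a₁)_j ⋯ (a_m)_j j!)`. -/
def hyp0F {m : ℕ} (a : Fin m → ℝ) (z : ℝ) : ℝ :=
  ∑' j : ℕ, 1 / (∏ i : Fin m, (ascPochhammer ℝ j).eval (a i)) * (z ^ j / (j.factorial : ℝ))

/-- The parameters `(2k, k, …, k)`, of length `m`. -/
def params (m : ℕ) (k : ℝ) (i : Fin m) : ℝ := if (i : ℕ) = 0 then 2 * k else k

/-- The standard simplex in the coordinates `(u₁, …, u_m)` (`u i` is `u_{i+1}`); the remaining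
barycentric coordinate is `u₀ = 1 - u₁ - ⋯ - u_m`. -/
def simplex (m : ℕ) : Set (Fin m → ℝ) := {u | (∀ i, 0 ≤ u i) ∧ 0 ≤ 1 - ∑ i, u i}

/-- The integrand, as a function of `u = (u₁, …, u_{n-1})`. -/
def integrand (n : ℕ) (k ρ φ r θ : ℝ) (u : Fin (n - 1) → ℝ) : ℝ :=
  let u₀ : ℝ := 1 - ∑ i, u i
  Real.exp (ρ * r * (u₀ * Real.cos (θ - φ) + ∑ i, u i * b n (θ - φ) ((i : ℕ) + 1))) *
    hyp0F (params (n - 1) k)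
      (-4 * (ρ * r / 2) ^ n * (u₀ * ∏ i, u i) * Real.sin (n * θ) * Real.sin (n * φ)) *
    (u₀ ^ (k - 1) * ∏ i, u i ^ (k - 1))

end Dihedral

end

/-! The kernel is expanded into homogeneous components, `E_k(·, y) = ∑ P_m`. In the direction `ξ =
x` the denominators of the Dunkl operator cancel (`dunklOp_self`), and Euler's identity turns the
radial eigenvalue equation into the recursion `(m+1+nk) P_{m+1} - k ∑_σ P_{m+1}∘σ = ⟨x,y⟩ P_m`, with
`σ` running over the reflections. A Neumann series solves it with factorial decay
(`exists_components`). The tangential equation follows from the radial one by induction on the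
degree (`tangential_step`), and an energy estimate gives uniqueness (`eq_zero_of_radial`). Hence
`dunklKernel` is the sum of these components.

On an orbit the recursion involves only two sums, `c_m` over the rotations and `d_m` over the
reflections. With weights `(nk)_m` their generating series `A`, `B` satisfy `(nk + X d/dX) A = k u
B` and `(nk + X d/dX) B = k v A`, where `u`, `v` are the sums of `1/(1 - lX)` over the values `l =
⟨wx, y⟩` in each coset (`eulerOp_orbitSum`). By a Chebyshev identity the two products `∏ (1 - lX)`
differ by a single monomial `δ X^n`, `δ = 4(ρr/2)^n sin(nθ) sin(nφ)` (`prod_one_sub_cos`,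
`nodePoly_reflect`). With `N` the product over the rotations, the system has the solution `(A +
B)/(2n) = N^{-k} ₂F₁(k, k; 2k; -δ X^n / N)` (`coeff_add_of_system`).

The coefficients of `N^{-κ}` are Dirichlet moments of the linear form `∑ u_s l_s`
(`integral_linear_pow`). Expanding the exponential and the hypergeometric factor of the integrand
and integrating termwise therefore gives a double series; regrouped by the total degree `nj + p`, it
is the expansion of the Bessel function. -/

noncomputable section

namespace Dihedral


/-! ### Rotations, roots and reflections in complex coordinates; sums over the two cosets. -/

/-- The rotation number `e^{2πij/n}`. -/
def zeta (n : ℕ) (j : ℤ) : ℂ := Complex.exp (((2 * Real.pi * (j : ℝ) / n : ℝ) : ℂ) * Complex.I)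

lemma zeta_add (n : ℕ) (i j : ℤ) : zeta n (i + j) = zeta n i * zeta n j := by
  unfold zeta
  rw [← Complex.exp_add]
  congr 1
  push_cast
  ring

lemma conj_zeta (n : ℕ) (j : ℤ) : (starRingEnd ℂ) (zeta n j) = zeta n (-j) := by
  unfold zeta
  rw [← Complex.exp_conj]
  rw [map_mul, Complex.conj_ofReal, Complex.conj_I]
  congr 1
  push_cast
  ring

lemma zeta_zero (n : ℕ) : zeta n 0 = 1 := by simp [zeta]

lemma norm_zeta (n : ℕ) (j : ℤ) : ‖zeta n j‖ = 1 := Complex.norm_exp_ofReal_mul_I _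

lemma zeta_add_n {n : ℕ} (hn : n ≠ 0) (j : ℤ) : zeta n (j + n) = zeta n j := by
  have h : zeta n n = 1 := by
    unfold zeta
    have : ((n : ℕ) : ℝ) ≠ 0 := by exact_mod_cast hn
    rw [show (2 * Real.pi * ((n : ℤ) : ℝ) / n : ℝ) = 2 * Real.pi by push_cast; field_simp]
    push_cast
    exact Complex.exp_two_pi_mul_I
  rw [zeta_add, h, mul_one]

lemma rotate_eq (n : ℕ) (j : Fin n) (x : ℂ) : rotate n j x = zeta n ((j : ℕ) : ℤ) * x := by
  simp [rotate, zeta]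

/-- Extension of `root` to all integer indices. -/
def zroot (n : ℕ) (j : ℤ) : ℂ :=
  -Complex.I * Complex.exp (((Real.pi * (j : ℝ) / n : ℝ) : ℂ) * Complex.I)

lemma root_eq (n : ℕ) (j : Fin n) : root n j = zroot n (((j : ℕ) : ℤ) + 1) := by
  simp [root, zroot]

lemma norm_zroot (n : ℕ) (j : ℤ) : ‖zroot n j‖ = 1 := by
  rw [zroot, norm_mul, Complex.norm_exp_ofReal_mul_I]
  simp

lemma norm_root (n : ℕ) (j : Fin n) : ‖root n j‖ = 1 := by
  rw [root_eq, norm_zroot]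

lemma zroot_add_n {n : ℕ} (hn : n ≠ 0) (j : ℤ) : zroot n (j + n) = -zroot n j := by
  unfold zroot
  have : ((n : ℕ) : ℝ) ≠ 0 := by exact_mod_cast hn
  rw [show (Real.pi * ((j + n : ℤ) : ℝ) / n : ℝ) = Real.pi * (j : ℝ) / n + Real.pi by
    push_cast; field_simp]
  push_cast
  rw [add_mul, Complex.exp_add, Complex.exp_pi_mul_I]
  ring

lemma zroot_sq (n : ℕ) (j : ℤ) : zroot n j ^ 2 = -zeta n j := by
  unfold zroot zeta
  rw [mul_pow, ← Complex.exp_nat_mul]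
  simp only [neg_sq, Complex.I_sq]
  rw [neg_one_mul]
  congr 2
  push_cast
  ring

lemma inner_eq_re (z w : ℂ) : inner ℝ z w = ((starRingEnd ℂ) z * w).re := by
  rw [Complex.inner, mul_comm]

/-- Writing a reflection as conjugation times a unimodular factor reduces every composition in the
group to addition of exponents. -/
lemma reflect_eq_neg_sq_mul {α : ℂ} (hα : ‖α‖ = 1) (x : ℂ) :
    reflect α x = -α ^ 2 * (starRingEnd ℂ) x := by
  have h1 : (starRingEnd ℂ) α * α = 1 := by
    rw [mul_comm, Complex.mul_conj, Complex.normSq_eq_norm_sq, hα]; simp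
  have h2 : ((2 * inner ℝ α x : ℝ) : ℂ) = (starRingEnd ℂ) α * x + α * (starRingEnd ℂ) x := by
    rw [inner_eq_re]
    have := Complex.add_conj ((starRingEnd ℂ) α * x)
    rw [map_mul, Complex.conj_conj] at this
    rw [this]
  unfold reflect
  rw [h2]
  linear_combination (-x) * h1

lemma reflect_root (n : ℕ) (j : Fin n) (x : ℂ) :
    reflect (root n j) x = zeta n (((j : ℕ) : ℤ) + 1) * (starRingEnd ℂ) x := by
  rw [reflect_eq_neg_sq_mul (norm_root n j), root_eq, zroot_sq, neg_neg]

/-- The reflection in a root, as a continuous linear map. -/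
def reflL (α : ℂ) : ℂ →L[ℝ] ℂ :=
  ContinuousLinearMap.id ℝ ℂ - (2 : ℝ) • (innerSL ℝ α).smulRight α

lemma reflL_apply (α x : ℂ) : reflL α x = reflect α x := by
  simp [reflL, reflect, mul_assoc]

lemma inner_reflect_reflect {α : ℂ} (hα : ‖α‖ = 1) (x z : ℂ) :
    inner ℝ (reflect α x) (reflect α z) = (inner ℝ x z : ℝ) := by
  have : ∀ c : ℂ, reflect α c = c - (2 * inner ℝ α c : ℝ) • α := fun c => by simp [reflect]
  simp only [this, inner_sub_left, inner_sub_right, inner_smul_left, inner_smul_right,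
    real_inner_self_eq_norm_sq, hα, real_inner_comm α]
  simp
  ring

lemma norm_reflect {α : ℂ} (hα : ‖α‖ = 1) (x : ℂ) : ‖reflect α x‖ = ‖x‖ := by
  have h := inner_reflect_reflect hα x x
  rw [real_inner_self_eq_norm_sq, real_inner_self_eq_norm_sq] at h
  exact (sq_eq_sq₀ (norm_nonneg _) (norm_nonneg _)).1 h

lemma norm_reflL_le {α : ℂ} (hα : ‖α‖ = 1) : ‖reflL α‖ ≤ 1 :=
  ContinuousLinearMap.opNorm_le_bound _ zero_le_one fun x => by
    rw [reflL_apply, norm_reflect hα, one_mul]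

lemma reflect_add (α x z : ℂ) : reflect α (x + z) = reflect α x + reflect α z := by
  simp only [← reflL_apply, map_add]

lemma reflect_smul (α : ℂ) (c : ℝ) (x : ℂ) : reflect α (c • x) = c • reflect α x := by
  simp only [← reflL_apply, map_smul]

/-- Reflections anticommute with the rotation through a right angle. -/
lemma reflect_I_mul {α : ℂ} (hα : ‖α‖ = 1) (x : ℂ) :
    reflect α (Complex.I * x) = -(Complex.I * reflect α x) := by
  rw [reflect_eq_neg_sq_mul hα, reflect_eq_neg_sq_mul hα]
  simp only [map_mul, Complex.conj_I]
  ring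

lemma sum_fin_eq_sum_zmod {n : ℕ} [NeZero n] {M : Type*} [AddCommMonoid M] (g : ℤ → M)
    (hg : ∀ j, g (j + n) = g j) (h : ZMod n → M) (hh : ∀ j : ℤ, h (j : ZMod n) = g j) :
    ∑ j : Fin n, g ((j : ℕ) : ℤ) = ∑ a : ZMod n, h a := by
  -- For a successor, `ZMod (m + 1)` is definitionally `Fin (m + 1)`, so both sums have the same
  -- index type.
  obtain ⟨m, rfl⟩ := Nat.exists_eq_succ_of_ne_zero (NeZero.ne n)
  refine Finset.sum_congr rfl fun j _ => ?_
  rw [← hh]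
  congr 1
  simp
  exact (Fin.cast_val_eq_self (n := m + 1) j)

/-- The value of an `n`-periodic function on `ℤ` at a residue class. -/
lemma periodic_descends {n : ℕ} {M : Type*} (g : ℤ → M) (hg : ∀ j, g (j + n) = g j) :
    ∃ h : ZMod n → M, ∀ j : ℤ, h (j : ZMod n) = g j := by
  have hg' : ∀ (t j : ℤ), g (j + t * n) = g j := by
    intro t
    induction t using Int.induction_on with
    | zero => simp
    | succ i ih => intro j; rw [add_mul, one_mul, ← add_assoc, hg, ih]
    | pred i ih =>
      intro j
      rw [← hg (j + _), ← ih j]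
      congr 1
      ring
  refine ⟨fun a => g (ZMod.cast a : ℤ), fun j => ?_⟩
  have h1 : (((ZMod.cast (j : ZMod n) : ℤ)) : ZMod n) = (j : ZMod n) := ZMod.intCast_zmod_cast _
  rw [ZMod.intCast_eq_intCast_iff_dvd_sub] at h1
  obtain ⟨t, ht⟩ := h1
  have h2 := hg' t (ZMod.cast (j : ZMod n) : ℤ)
  rw [mul_comm t, ← ht, add_sub_cancel] at h2
  exact h2.symm

lemma sum_periodic_add {n : ℕ} (hn : n ≠ 0) {M : Type*} [AddCommMonoid M] (g : ℤ → M)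
    (hg : ∀ j, g (j + n) = g j) (c : ℤ) :
    ∑ j : Fin n, g (c + ((j : ℕ) : ℤ)) = ∑ j : Fin n, g ((j : ℕ) : ℤ) := by
  have : NeZero n := ⟨hn⟩
  obtain ⟨h, hh⟩ := periodic_descends g hg
  rw [sum_fin_eq_sum_zmod g hg h hh,
    sum_fin_eq_sum_zmod (fun j => g (c + j)) (fun j => by rw [← add_assoc, hg])
      (fun a => h ((c : ZMod n) + a)) (fun j => by rw [← hh]; push_cast; rfl)]
  exact Equiv.sum_comp (Equiv.addLeft (c : ZMod n)) h

lemma sum_periodic_sub {n : ℕ} (hn : n ≠ 0) {M : Type*} [AddCommMonoid M] (g : ℤ → M)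
    (hg : ∀ j, g (j + n) = g j) (c : ℤ) :
    ∑ j : Fin n, g (c - ((j : ℕ) : ℤ)) = ∑ j : Fin n, g ((j : ℕ) : ℤ) := by
  have : NeZero n := ⟨hn⟩
  obtain ⟨h, hh⟩ := periodic_descends g hg
  rw [sum_fin_eq_sum_zmod g hg h hh,
    sum_fin_eq_sum_zmod (fun j => g (c - j))
      (fun j => by rw [← hg (c - (j + n))]; congr 1; ring)
      (fun a => h ((c : ZMod n) - a)) (fun j => by rw [← hh]; push_cast; rfl)]
  exact Equiv.sum_comp (Equiv.subLeft (c : ZMod n)) h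

/-- Roots are indexed from `1` and rotations from `0`; periodicity absorbs the shift. -/
lemma sum_reflect_root {n : ℕ} (hn : n ≠ 0) {M : Type*} [AddCommMonoid M] (g : ℂ → M) (x : ℂ) :
    ∑ j : Fin n, g (reflect (root n j) x)
      = ∑ j : Fin n, g (zeta n ((j : ℕ) : ℤ) * (starRingEnd ℂ) x) := by
  rw [← sum_periodic_add hn (fun j => g (zeta n j * (starRingEnd ℂ) x))
    (fun j => by rw [zeta_add_n hn]) 1]
  exact Finset.sum_congr rfl fun j _ => by rw [reflect_root, add_comm]

/-- Reflections composed with a fixed group element run through a whole coset: reflections here,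
rotations in `sum_reflect_reflect`. This is why orbit sums satisfy a closed system with two
unknowns. -/
lemma sum_reflect_rotate {n : ℕ} (hn : n ≠ 0) {M : Type*} [AddCommMonoid M] (g : ℂ → M) (x : ℂ)
    (i : Fin n) :
    ∑ j : Fin n, g (reflect (root n j) (rotate n i x))
      = ∑ j : Fin n, g (reflect (root n j) x) := by
  rw [sum_reflect_root hn, sum_reflect_root hn,
    ← sum_periodic_add hn (fun j => g (zeta n j * (starRingEnd ℂ) x))
    (fun j => by rw [zeta_add_n hn]) (-((i : ℕ) : ℤ))]
  refine Finset.sum_congr rfl fun j _ => ?_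
  rw [rotate_eq, map_mul, conj_zeta, ← mul_assoc, ← zeta_add, add_comm]

lemma sum_reflect_reflect {n : ℕ} (hn : n ≠ 0) {M : Type*} [AddCommMonoid M] (g : ℂ → M) (x : ℂ)
    (i : Fin n) :
    ∑ j : Fin n, g (reflect (root n j) (reflect (root n i) x))
      = ∑ j : Fin n, g (rotate n j x) := by
  simp only [rotate_eq]
  rw [sum_reflect_root hn,
    ← sum_periodic_add hn (fun j => g (zeta n j * x))
    (fun j => by rw [zeta_add_n hn]) (-(((i : ℕ) : ℤ) + 1))]
  refine Finset.sum_congr rfl fun j _ => ?_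
  rw [reflect_root, map_mul, conj_zeta, ← mul_assoc, ← zeta_add, add_comm, Complex.conj_conj]

lemma reflect_root_zroot (n : ℕ) (i : Fin n) (j : ℤ) :
    reflect (root n i) (zroot n j) = -zroot n (2 * (((i : ℕ) : ℤ) + 1) - j) := by
  rw [reflect_root]
  unfold zroot zeta
  rw [map_mul, map_neg, Complex.conj_I, ← Complex.exp_conj, neg_neg, neg_mul, neg_neg,
    mul_left_comm, ← Complex.exp_add]
  congr 2
  simp only [map_mul, Complex.conj_ofReal, Complex.conj_I]
  push_cast
  ring

/-- A sum over the positive roots of an even function may be reflected. -/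
lemma sum_even_reflect_root {n : ℕ} (hn : n ≠ 0) {M : Type*} [AddCommMonoid M] (g : ℂ → M)
    (hg : ∀ z, g (-z) = g z) (i : Fin n) :
    ∑ j : Fin n, g (reflect (root n i) (root n j)) = ∑ j : Fin n, g (root n j) := by
  -- `zroot` itself is only antiperiodic; evenness of `g` restores the period `n`.
  have hp : ∀ j : ℤ, g (zroot n (j + n)) = g (zroot n j) := fun j => by
    rw [zroot_add_n hn, hg]
  simp only [root_eq n _]
  rw [← root_eq]
  simp only [reflect_root_zroot, hg]
  -- The reflection sends index `j` to `2(i+1) - j`; the final `- 1` accounts for the roots starting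
  -- at index `1`.
  have h1 := sum_periodic_sub hn (fun j => g (zroot n j)) hp (2 * (((i : ℕ) : ℤ) + 1) - 1)
  have h2 := sum_periodic_add hn (fun j => g (zroot n j)) hp 1
  rw [← h2] at h1
  simp only [add_comm (1 : ℤ)] at h1
  rw [← h1]
  refine Finset.sum_congr rfl fun j _ => ?_
  congr 2
  ring


/-! ### Algebra of the Dunkl operators: equivariance, linearity, product rule. -/

lemma diffQuot_neg (f : ℂ → ℝ) (α x : ℂ) : diffQuot f (-α) x = -diffQuot f α x := by
  have h : reflect (-α) x = reflect α x := by
    unfold reflect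
    rw [inner_neg_left]
    push_cast
    ring
  unfold diffQuot
  rw [h, inner_neg_left, map_neg]
  by_cases h0 : inner ℝ α x = (0 : ℝ)
  · rw [if_pos h0, if_pos (by rw [h0, neg_zero]), mul_neg]
  · rw [if_neg h0, if_neg (neg_ne_zero.2 h0), div_neg]

lemma hasFDerivAt_comp_reflect {f : ℂ → ℝ} (hf : Differentiable ℝ f) (β x : ℂ) :
    HasFDerivAt (fun x => f (reflect β x)) ((fderiv ℝ f (reflect β x)).comp (reflL β)) x := by
  have h1 : HasFDerivAt (reflect β) (reflL β) x := by
    have := (reflL β).hasFDerivAt (x := x)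
    rwa [show (⇑(reflL β) : ℂ → ℂ) = reflect β from funext (reflL_apply β)] at this
  exact (hf (reflect β x)).hasFDerivAt.comp x h1

lemma differentiable_comp_reflect {f : ℂ → ℝ} (hf : Differentiable ℝ f) (β : ℂ) :
    Differentiable ℝ (fun x => f (reflect β x)) :=
  fun x => (hasFDerivAt_comp_reflect hf β x).differentiableAt

lemma fderiv_comp_reflect {f : ℂ → ℝ} (hf : Differentiable ℝ f) (β x ξ : ℂ) :
    fderiv ℝ (fun x => f (reflect β x)) x ξ = fderiv ℝ f (reflect β x) (reflect β ξ) := by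
  rw [(hasFDerivAt_comp_reflect hf β x).fderiv, ContinuousLinearMap.comp_apply, reflL_apply]

lemma reflect_reflect_conj {β : ℂ} (hβ : ‖β‖ = 1) (α x : ℂ) :
    reflect β (reflect α x) = reflect (reflect β α) (reflect β x) := by
  have : ∀ a c : ℂ, reflect a c = c + (-(2 * inner ℝ a c : ℝ)) • a := fun a c => by
    simp [reflect, sub_eq_add_neg]
  rw [this α x, reflect_add, reflect_smul, this (reflect β α), inner_reflect_reflect hβ]

lemma diffQuot_comp_reflect {f : ℂ → ℝ} (hf : Differentiable ℝ f) {β : ℂ} (hβ : ‖β‖ = 1)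
    (α x : ℂ) :
    diffQuot (fun x => f (reflect β x)) α x = diffQuot f (reflect β α) (reflect β x) := by
  unfold diffQuot
  simp only [inner_reflect_reflect hβ, fderiv_comp_reflect hf, reflect_reflect_conj hβ]

/-- Equivariance of the Dunkl operators under the reflections of the group. -/
lemma dunklOp_comp_reflect {n : ℕ} (hn : n ≠ 0) (k : ℝ) {f : ℂ → ℝ} (hf : Differentiable ℝ f)
    (i : Fin n) (ξ x : ℂ) :
    dunklOp n k ξ (fun x => f (reflect (root n i) x)) x
      = dunklOp n k (reflect (root n i) ξ) f (reflect (root n i) x) := by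
  unfold dunklOp
  rw [fderiv_comp_reflect hf]
  congr 2
  rw [← sum_even_reflect_root hn (fun α => inner ℝ α (reflect (root n i) ξ) *
    diffQuot f α (reflect (root n i) x))
    (fun z => by rw [inner_neg_left, diffQuot_neg, neg_mul_neg]) i]
  exact Finset.sum_congr rfl fun j _ => by
    rw [diffQuot_comp_reflect hf (norm_root n i), inner_reflect_reflect (norm_root n i)]

lemma dunklOp_neg_left (n : ℕ) (k : ℝ) (ξ : ℂ) (f : ℂ → ℝ) (x : ℂ) :
    dunklOp n k (-ξ) f x = -dunklOp n k ξ f x := by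
  unfold dunklOp
  simp only [map_neg, inner_neg_right, neg_mul, Finset.sum_neg_distrib, mul_neg]
  ring

lemma dunklOp_add_left (n : ℕ) (k : ℝ) (ξ η : ℂ) (f : ℂ → ℝ) (x : ℂ) :
    dunklOp n k (ξ + η) f x = dunklOp n k ξ f x + dunklOp n k η f x := by
  unfold dunklOp
  simp only [map_add, inner_add_right, add_mul, Finset.sum_add_distrib, mul_add]
  ring

lemma dunklOp_smul_left (n : ℕ) (k : ℝ) (c : ℝ) (ξ : ℂ) (f : ℂ → ℝ) (x : ℂ) :
    dunklOp n k (c • ξ) f x = c * dunklOp n k ξ f x := by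
  unfold dunklOp
  simp only [map_smul, inner_smul_right, smul_eq_mul, mul_add, Finset.mul_sum]
  congr 1
  exact Finset.sum_congr rfl fun j _ => by ring

lemma diffQuot_add {f g : ℂ → ℝ} (hf : Differentiable ℝ f) (hg : Differentiable ℝ g) (α x : ℂ) :
    diffQuot (fun x => f x + g x) α x = diffQuot f α x + diffQuot g α x := by
  unfold diffQuot
  rw [fderiv_fun_add (hf x) (hg x)]
  split_ifs
  · simp [mul_add]
  · rw [← add_div]; ring

lemma dunklOp_add (n : ℕ) (k : ℝ) (ξ : ℂ) {f g : ℂ → ℝ} (hf : Differentiable ℝ f)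
    (hg : Differentiable ℝ g) (x : ℂ) :
    dunklOp n k ξ (fun x => f x + g x) x = dunklOp n k ξ f x + dunklOp n k ξ g x := by
  unfold dunklOp
  simp only [diffQuot_add hf hg, fderiv_fun_add (hf x) (hg x), mul_add, Finset.sum_add_distrib,
    add_apply]
  ring

lemma dunklOp_const_mul (n : ℕ) (k : ℝ) (ξ : ℂ) {f : ℂ → ℝ} (hf : Differentiable ℝ f) (c : ℝ)
    (x : ℂ) :
    dunklOp n k ξ (fun x => c * f x) x = c * dunklOp n k ξ f x := by
  have h : ∀ α, diffQuot (fun x => c * f x) α x = c * diffQuot f α x := by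
    intro α
    unfold diffQuot
    rw [fderiv_const_mul (hf x)]
    split_ifs
    · simp only [smul_apply, smul_eq_mul]; ring
    · rw [← mul_sub, mul_div_assoc]
  unfold dunklOp
  simp only [h, fderiv_const_mul (hf x), smul_apply, smul_eq_mul,
    mul_add, Finset.mul_sum]
  congr 1
  exact Finset.sum_congr rfl fun j _ => by ring

lemma dunklOp_const (n : ℕ) (k : ℝ) (ξ : ℂ) (c : ℝ) (x : ℂ) :
    dunklOp n k ξ (fun _ => c) x = 0 := by
  simp [dunklOp, diffQuot]

lemma dunklOp_sum (n : ℕ) (k : ℝ) (ξ : ℂ) {ι : Type*} (s : Finset ι) (f : ι → ℂ → ℝ)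
    (hf : ∀ i, Differentiable ℝ (f i)) (x : ℂ) :
    dunklOp n k ξ (fun x => ∑ i ∈ s, f i x) x = ∑ i ∈ s, dunklOp n k ξ (f i) x := by
  classical
  induction s using Finset.induction_on with
  | empty => simpa using dunklOp_const n k ξ 0 x
  | insert a s ha ih =>
    simp only [Finset.sum_insert ha]
    rw [dunklOp_add n k ξ (hf a) (Differentiable.fun_sum fun i _ => hf i), ih]

lemma two_inner_root_mul (α ξ y : ℂ) :
    2 * inner ℝ α ξ * inner ℝ α y = (inner ℝ (ξ - reflect α ξ) y : ℝ) := by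
  have : ξ - reflect α ξ = (2 * inner ℝ α ξ : ℝ) • α := by simp [reflect]
  rw [this, inner_smul_left]
  simp

lemma hasFDerivAt_inner_mul (y : ℂ) {g : ℂ → ℝ} (hg : Differentiable ℝ g) (x : ℂ) :
    HasFDerivAt (fun x => inner ℝ x y * g x)
      ((inner ℝ x y : ℝ) • fderiv ℝ g x + g x • innerSL ℝ y) x := by
  have h1 : HasFDerivAt (fun x : ℂ => (inner ℝ x y : ℝ)) (innerSL ℝ y) x := by
    have := (innerSL ℝ y).hasFDerivAt (x := x)
    rwa [show (⇑(innerSL ℝ y) : ℂ → ℝ) = fun x => inner ℝ x y from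
      funext fun x => by rw [innerSL_apply_apply, real_inner_comm]] at this
  exact h1.mul (hg x).hasFDerivAt

lemma diffQuot_inner_mul (y : ℂ) {g : ℂ → ℝ} (hg : Differentiable ℝ g) (α x : ℂ) :
    diffQuot (fun x => inner ℝ x y * g x) α x
      = inner ℝ x y * diffQuot g α x + 2 * inner ℝ α y * g (reflect α x) := by
  unfold diffQuot
  split_ifs with h
  · have hx : reflect α x = x := by simp [reflect, h]
    rw [(hasFDerivAt_inner_mul y hg x).fderiv, hx]
    simp only [add_apply, smul_apply, innerSL_apply_apply, smul_eq_mul, real_inner_comm α y]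
    ring
  · have h2 := two_inner_root_mul α x y
    rw [inner_sub_left] at h2
    field_simp
    linear_combination (-g (reflect α x)) * h2

/-- Each difference quotient adds a term `2⟨α,y⟩ g(σ_α x)`, and `2⟨α,ξ⟩α = ξ - σ_α ξ`. This
commutator drives the induction on the degree. -/
lemma dunklOp_inner_mul (n : ℕ) (k : ℝ) (ξ y : ℂ) {g : ℂ → ℝ} (hg : Differentiable ℝ g) (x : ℂ) :
    dunklOp n k ξ (fun x => inner ℝ x y * g x) x
      = inner ℝ x y * dunklOp n k ξ g x + inner ℝ ξ y * g x
        + k * ∑ j : Fin n, (inner ℝ ξ y - inner ℝ (reflect (root n j) ξ) y)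
            * g (reflect (root n j) x) := by
  unfold dunklOp
  simp only [diffQuot_inner_mul y hg, (hasFDerivAt_inner_mul y hg x).fderiv]
  simp only [add_apply, smul_apply, innerSL_apply_apply, smul_eq_mul, real_inner_comm ξ y,
    ← inner_sub_left, ← two_inner_root_mul]
  have : ∀ j : Fin n, inner ℝ (root n j) ξ * (inner ℝ x y * diffQuot g (root n j) x +
      2 * inner ℝ (root n j) y * g (reflect (root n j) x))
      = inner ℝ x y * (inner ℝ (root n j) ξ * diffQuot g (root n j) x)
        + 2 * inner ℝ (root n j) ξ * inner ℝ (root n j) y * g (reflect (root n j) x) :=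
    fun j => by ring
  simp only [this, Finset.sum_add_distrib, ← Finset.mul_sum]
  ring

/-- For `ξ = x` the factor `⟨α, x⟩` cancels the denominator; on the mirror `⟨α, x⟩ = 0` both
contributions vanish. The radial equation is thus free of singular quotients. -/
lemma dunklOp_self (n : ℕ) (k : ℝ) (f : ℂ → ℝ) (x : ℂ) :
    dunklOp n k x f x = fderiv ℝ f x x + k * (n * f x - ∑ j : Fin n, f (reflect (root n j) x)) := by
  unfold dunklOp
  congr 2
  rw [show (n : ℝ) * f x = ∑ _j : Fin n, f x by simp, ← Finset.sum_sub_distrib]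
  refine Finset.sum_congr rfl fun j _ => ?_
  unfold diffQuot
  split_ifs with h
  · have hx : reflect (root n j) x = x := by simp [reflect, h]
    rw [h, hx]; ring
  · field_simp

/-- If `c V = -k ∑ V ∘ σ` over the reflections of the group, with `c > kn`, then `V = 0`. -/
lemma eq_zero_of_reflection_sum {n : ℕ} (hn : n ≠ 0) {k c : ℝ} (hk : 0 < k) (hc : k * n < c)
    (V : ℂ → ℝ) (hV : ∀ x, c * V x + k * ∑ j : Fin n, V (reflect (root n j) x) = 0) (x : ℂ) :
    V x = 0 := by
  have hc0 : 0 < c := lt_of_le_of_lt (by positivity) hc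
  set A := ∑ j : Fin n, |V (rotate n j x)| with hA
  set B := ∑ j : Fin n, |V (reflect (root n j) x)| with hB
  have hbound : ∀ z, c * |V z| ≤ k * ∑ j : Fin n, |V (reflect (root n j) z)| := by
    intro z
    have h1 : c * |V z| = |k * ∑ j : Fin n, V (reflect (root n j) z)| := by
      rw [show c * |V z| = |c * V z| by rw [abs_mul, abs_of_pos hc0],
        show c * V z = -(k * ∑ j : Fin n, V (reflect (root n j) z)) by linarith [hV z], abs_neg]
    rw [h1, abs_mul, abs_of_pos hk]
    exact mul_le_mul_of_nonneg_left (Finset.abs_sum_le_sum_abs _ _) hk.le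
  have h1 : c * A ≤ k * n * B := by
    rw [hA, Finset.mul_sum]
    refine (Finset.sum_le_sum fun j _ => hbound _).trans (le_of_eq ?_)
    simp only [sum_reflect_rotate hn (fun z => |V z|)]
    simp [hB]; ring
  have h2 : c * B ≤ k * n * A := by
    rw [hB, Finset.mul_sum]
    refine (Finset.sum_le_sum fun j _ => hbound _).trans (le_of_eq ?_)
    simp only [sum_reflect_reflect hn (fun z => |V z|)]
    simp [hA]; ring
  have hA0 : 0 ≤ A := Finset.sum_nonneg fun _ _ => abs_nonneg _
  have hB0 : 0 ≤ B := Finset.sum_nonneg fun _ _ => abs_nonneg _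
  -- The two bounds combine to `c² A ≤ (kn)² A` with `kn < c`.
  have hAz : A = 0 := by
    by_contra hne
    have hpos : 0 < A := lt_of_le_of_ne hA0 (Ne.symm hne)
    nlinarith
  have h0 := (Finset.sum_eq_zero_iff_of_nonneg (fun _ _ => abs_nonneg _)).1 hAz
    ⟨0, Nat.pos_of_ne_zero hn⟩ (Finset.mem_univ _)
  simpa [rotate] using h0

/-- The tangential Dunkl equation follows from the radial one, degree by degree. -/
lemma tangential_step {n : ℕ} (hn : n ≠ 0) {k c : ℝ} (hk : 0 < k) (hc : k * n < c) (y : ℂ)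
    {P Q Q' : ℂ → ℝ} (hP : Differentiable ℝ P) (hQ : Differentiable ℝ Q)
    (hPQ : ∀ x, c * P x - k * ∑ j : Fin n, P (reflect (root n j) x) = inner ℝ x y * Q x)
    (hQQ' : ∀ x, (c - 1) * Q x - k * ∑ j : Fin n, Q (reflect (root n j) x) = inner ℝ x y * Q' x)
    (hT : ∀ x, dunklOp n k (Complex.I * x) Q x = inner ℝ (Complex.I * x) y * Q' x) (x : ℂ) :
    dunklOp n k (Complex.I * x) P x = inner ℝ (Complex.I * x) y * Q x := by
  have key := eq_zero_of_reflection_sum hn hk hc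
    (fun x => dunklOp n k (Complex.I * x) P x - inner ℝ (Complex.I * x) y * Q x) ?_ x
  · exact sub_eq_zero.1 key
  intro x
  -- The operator in the frozen direction `I * x` is applied to `hPQ`. Equivariance and `σ(Ix) =
  -- -Iσx` reverse the sign of the reflection sum, and `hQQ'` then eliminates `Q'`, leaving the
  -- hypothesis of `eq_zero_of_reflection_sum` for the defect.
  have h1 : dunklOp n k (Complex.I * x)
      (fun x => c * P x + (-k) * ∑ j : Fin n, P (reflect (root n j) x)) x
      = dunklOp n k (Complex.I * x) (fun x => inner ℝ x y * Q x) x := by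
    congr 1
    funext x
    rw [← hPQ x]; ring
  have hPj : ∀ j : Fin n, Differentiable ℝ (fun x => P (reflect (root n j) x)) :=
    fun j => differentiable_comp_reflect hP _
  have hS : Differentiable ℝ (fun x => ∑ j : Fin n, P (reflect (root n j) x)) :=
    Differentiable.fun_sum fun j _ => hPj j
  rw [dunklOp_add _ _ _ (hP.const_mul c) (hS.const_mul (-k)), dunklOp_const_mul _ _ _ hP,
    dunklOp_const_mul _ _ _ hS, dunklOp_sum _ _ _ _ _ hPj, dunklOp_inner_mul _ _ _ _ hQ, hT] at h1
  simp only [dunklOp_comp_reflect hn k hP, reflect_I_mul (norm_root n _), dunklOp_neg_left,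
    inner_neg_left, Finset.sum_neg_distrib, sub_neg_eq_add, add_mul, Finset.sum_add_distrib,
    ← Finset.mul_sum] at h1
  simp only [Finset.sum_sub_distrib]
  linear_combination h1 - inner ℝ (Complex.I * x) y * hQQ' x


/-! ### Existence of the Dunkl kernel through its homogeneous components. -/

section

/-- Multiplication of a homogeneous polynomial of degree `m` by the linear form `⟨·, y⟩`. -/
def mulForm (y : ℂ) {m : ℕ} (M : ContinuousMultilinearMap ℝ (fun _ : Fin m => ℂ) ℝ) :
    ContinuousMultilinearMap ℝ (fun _ : Fin (m + 1) => ℂ) ℝ :=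
  ContinuousLinearMap.uncurryLeft (Ei := fun _ : Fin (m + 1) => ℂ) ((innerSL ℝ y).smulRight M)

lemma mulForm_diag (y : ℂ) {m : ℕ} (M : ContinuousMultilinearMap ℝ (fun _ : Fin m => ℂ) ℝ)
    (x : ℂ) : mulForm y M (fun _ => x) = inner ℝ x y * M (fun _ => x) := by
  simp only [mulForm, ContinuousLinearMap.uncurryLeft_apply, ContinuousLinearMap.smulRight_apply,
    smul_apply, innerSL_apply_apply, smul_eq_mul, real_inner_comm]
  rfl

lemma norm_mulForm (y : ℂ) {m : ℕ} (M : ContinuousMultilinearMap ℝ (fun _ : Fin m => ℂ) ℝ) :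
    ‖mulForm y M‖ = ‖y‖ * ‖M‖ := by
  unfold mulForm
  rw [ContinuousLinearMap.uncurryLeft_norm, ContinuousLinearMap.norm_smulRight_apply,
    innerSL_apply_norm]

/-- The sum of the reflections of the group acting on homogeneous polynomials of degree `m`. -/
def reflSum (n m : ℕ) : ContinuousMultilinearMap ℝ (fun _ : Fin m => ℂ) ℝ →L[ℝ]
    ContinuousMultilinearMap ℝ (fun _ : Fin m => ℂ) ℝ :=
  ∑ j : Fin n, ContinuousMultilinearMap.compContinuousLinearMapL
    (fun _ : Fin m => reflL (root n j))

lemma reflSum_diag (n m : ℕ) (M : ContinuousMultilinearMap ℝ (fun _ : Fin m => ℂ) ℝ) (x : ℂ) :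
    reflSum n m M (fun _ => x) = ∑ j : Fin n, M (fun _ => reflect (root n j) x) := by
  simp [reflSum, reflL_apply]

lemma norm_reflSum_le (n m : ℕ) : ‖reflSum n m‖ ≤ n := by
  unfold reflSum
  refine (norm_sum_le (E := (ℂ [×m]→L[ℝ] ℝ) →L[ℝ] ℂ [×m]→L[ℝ] ℝ) _ _).trans ?_
  refine (Finset.sum_le_sum (g := fun _ => (1 : ℝ)) fun j _ => ?_).trans (by simp)
  refine (ContinuousMultilinearMap.norm_compContinuousLinearMapL_le ℝ _).trans ?_
  exact Finset.prod_le_one (fun _ _ => norm_nonneg _) fun _ _ => norm_reflL_le (norm_root n j)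

/-- `1 - (k/c) T` is inverted by a Neumann series, and the triangle inequality bounds `w`. For the
reflection sum, `a = n` and `c = m+1+nk`, so that `c - ka = m+1`: this is the source of the factor
`1/m!` in the norms. -/
lemma exists_resolvent {V : Type*} [NormedAddCommGroup V] [NormedSpace ℝ V] [CompleteSpace V]
    (T : V →L[ℝ] V) {k a c : ℝ} (hk : 0 < k) (ha : 0 ≤ a) (hT : ‖T‖ ≤ a) (hc : k * a < c) (v : V) :
    ∃ w : V, c • w - k • T w = v ∧ (c - k * a) * ‖w‖ ≤ ‖v‖ := by
  have hc0 : 0 < c := lt_of_le_of_lt (by positivity) hc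
  have hlt : ‖(k / c) • T‖ < 1 := by
    rw [norm_smul, Real.norm_of_nonneg (by positivity), div_mul_eq_mul_div, div_lt_one hc0]
    exact (mul_le_mul_of_nonneg_left hT hk.le).trans_lt hc
  obtain ⟨u, hu⟩ := isUnit_one_sub_of_norm_lt_one hlt
  have h1 : (1 - (k / c) • T) * (↑u⁻¹ : V →L[ℝ] V) = 1 := by rw [← hu, Units.mul_inv]
  have h2 := congrArg (fun T : V →L[ℝ] V => T (c⁻¹ • v)) h1
  simp only [mul_apply_eq_comp, sub_apply, smul_apply,
    one_apply_eq_self] at h2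
  set w := (↑u⁻¹ : V →L[ℝ] V) (c⁻¹ • v)
  have h3 : c • w - k • T w = v := by
    have := congrArg (fun z => c • z) h2
    simp only [smul_sub, smul_smul, mul_div_cancel₀ k hc0.ne', mul_inv_cancel₀ hc0.ne',
      one_smul] at this
    exact this
  refine ⟨w, h3, ?_⟩
  have h4 : c * ‖w‖ ≤ ‖v‖ + k * a * ‖w‖ := by
    calc c * ‖w‖ = ‖c • w‖ := by rw [norm_smul, Real.norm_of_nonneg hc0.le]
      _ = ‖v + k • T w‖ := by rw [← h3]; congr 1; abel
      _ ≤ ‖v‖ + ‖k • T w‖ := norm_add_le _ _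
      _ ≤ ‖v‖ + k * a * ‖w‖ := by
        gcongr
        rw [norm_smul, Real.norm_of_nonneg hk.le, mul_assoc]
        gcongr
        exact T.le_of_opNorm_le hT w
  linarith

/-- The homogeneous components of the Dunkl kernel. -/
lemma exists_components (n : ℕ) {k : ℝ} (hk : 0 < k) (y : ℂ) :
    ∃ M : FormalMultilinearSeries ℝ ℂ ℝ, (∀ x, M 0 (fun _ => x) = 1) ∧
      (∀ m, ‖M m‖ ≤ ‖y‖ ^ m / (m.factorial : ℝ)) ∧
      ∀ m : ℕ, (m + 1 + n * k : ℝ) • M (m + 1) - k • reflSum n (m + 1) (M (m + 1))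
        = mulForm y (M m) := by
  have hc : ∀ m : ℕ, k * n < (m + 1 + n * k : ℝ) := fun m => by
    have : (0 : ℝ) ≤ m := Nat.cast_nonneg m
    linarith [mul_comm k n]
  choose F hF1 hF2 using fun (m : ℕ) (N : ContinuousMultilinearMap ℝ (fun _ : Fin m => ℂ) ℝ) =>
    exists_resolvent (reflSum n (m + 1)) hk (Nat.cast_nonneg n) (norm_reflSum_le n (m + 1)) (hc m)
      (mulForm y N)
  let M : FormalMultilinearSeries ℝ ℂ ℝ := fun m => Nat.rec
    (motive := fun m => ContinuousMultilinearMap ℝ (fun _ : Fin m => ℂ) ℝ)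
    (ContinuousMultilinearMap.constOfIsEmpty ℝ (fun _ : Fin 0 => ℂ) (1 : ℝ)) (fun m N => F m N) m
  have hM0 : M 0 = ContinuousMultilinearMap.constOfIsEmpty ℝ (fun _ : Fin 0 => ℂ) (1 : ℝ) := rfl
  have hM1 : ∀ m, M (m + 1) = F m (M m) := fun m => rfl
  refine ⟨M, fun x => by rw [hM0]; rfl, fun m => ?_, fun m => by rw [hM1]; exact hF1 m (M m)⟩
  induction m with
  | zero => rw [hM0]; simp
  | succ m ih =>
    have h := hF2 m (M m)
    rw [← hM1, norm_mulForm] at h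
    have hm : (0 : ℝ) < m + 1 := by positivity
    rw [show (m + 1 + n * k - k * n : ℝ) = m + 1 by ring] at h
    rw [Nat.factorial_succ, pow_succ]
    push_cast
    rw [le_div_iff₀ (by positivity)]
    calc ‖M (m + 1)‖ * ((m + 1 : ℝ) * (m.factorial : ℝ))
        = ((m + 1 : ℝ) * ‖M (m + 1)‖) * (m.factorial : ℝ) := by ring
      _ ≤ ‖y‖ * ‖M m‖ * (m.factorial : ℝ) := by gcongr
      _ ≤ ‖y‖ * (‖y‖ ^ m / (m.factorial : ℝ)) * (m.factorial : ℝ) := by gcongr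
      _ = ‖y‖ ^ m * ‖y‖ := by field_simp

/-- The homogeneous polynomial attached to a multilinear map. -/
def diagPoly {m : ℕ} (N : ContinuousMultilinearMap ℝ (fun _ : Fin m => ℂ) ℝ) (x : ℂ) : ℝ :=
  N (fun _ => x)

lemma diagPoly_smul {m : ℕ} (N : ContinuousMultilinearMap ℝ (fun _ : Fin m => ℂ) ℝ) (c : ℝ)
    (x : ℂ) : diagPoly N (c • x) = c ^ m * diagPoly N x := by
  have := N.map_smul_univ (fun _ => c) (fun _ => x)
  simpa [diagPoly] using this

lemma abs_diagPoly_le {m : ℕ} (N : ContinuousMultilinearMap ℝ (fun _ : Fin m => ℂ) ℝ) (x : ℂ) :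
    |diagPoly N x| ≤ ‖N‖ * ‖x‖ ^ m := by
  have := N.le_opNorm (fun _ => x)
  simpa [diagPoly] using this

lemma hasFDerivAt_diagPoly {m : ℕ} (N : ContinuousMultilinearMap ℝ (fun _ : Fin m => ℂ) ℝ)
    (x : ℂ) : HasFDerivAt (diagPoly N)
      (∑ i, (N.toContinuousLinearMap (fun _ => x) i).comp (ContinuousLinearMap.id ℝ ℂ)) x :=
  HasFDerivAt.multilinear_comp N fun _ => hasFDerivAt_id x

lemma differentiable_diagPoly {m : ℕ} (N : ContinuousMultilinearMap ℝ (fun _ : Fin m => ℂ) ℝ) :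
    Differentiable ℝ (diagPoly N) := fun x => (hasFDerivAt_diagPoly N x).differentiableAt

lemma norm_fderiv_diagPoly_le {m : ℕ} (N : ContinuousMultilinearMap ℝ (fun _ : Fin m => ℂ) ℝ)
    (x : ℂ) : ‖fderiv ℝ (diagPoly N) x‖ ≤ m * ‖N‖ * ‖x‖ ^ (m - 1) := by
  refine ContinuousLinearMap.opNorm_le_bound _ (by positivity) fun ξ => ?_
  rw [(hasFDerivAt_diagPoly N x).fderiv, sum_apply]
  refine (norm_sum_le _ _).trans ?_
  refine (Finset.sum_le_sum (g := fun _ => ‖N‖ * ‖x‖ ^ (m - 1) * ‖ξ‖) fun i _ => ?_).trans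
    (by simp; apply le_of_eq; ring)
  simp only [ContinuousLinearMap.comp_apply, ContinuousLinearMap.id_apply,
    ContinuousMultilinearMap.toContinuousLinearMap_apply]
  refine (N.le_opNorm _).trans ?_
  rw [mul_assoc]
  refine mul_le_mul_of_nonneg_left (le_of_eq ?_) (norm_nonneg _)
  rw [← Finset.mul_prod_erase _ _ (Finset.mem_univ i), Function.update_self, mul_comm]
  congr 1
  rw [Finset.prod_congr rfl (g := fun _ => ‖x‖) fun j hj => by
    rw [Function.update_of_ne (Finset.ne_of_mem_erase hj)]]
  simp

lemma fderiv_diagPoly_self {m : ℕ} (N : ContinuousMultilinearMap ℝ (fun _ : Fin m => ℂ) ℝ)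
    (x : ℂ) : fderiv ℝ (diagPoly N) x x = m * diagPoly N x := by
  rw [(hasFDerivAt_diagPoly N x).fderiv, sum_apply]
  simp [diagPoly]

/-- The recursion satisfied by the homogeneous components of the Dunkl kernel. -/
structure IsComponents (n : ℕ) (k : ℝ) (y : ℂ) (M : FormalMultilinearSeries ℝ ℂ ℝ) : Prop where
  zero : ∀ x, diagPoly (M 0) x = 1
  norm_le : ∀ m, ‖M m‖ ≤ ‖y‖ ^ m / (m.factorial : ℝ)
  succ : ∀ (m : ℕ) (x : ℂ), (m + 1 + n * k : ℝ) * diagPoly (M (m + 1)) x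
    - k * ∑ j : Fin n, diagPoly (M (m + 1)) (reflect (root n j) x) = inner ℝ x y * diagPoly (M m) x

lemma exists_isComponents (n : ℕ) {k : ℝ} (hk : 0 < k) (y : ℂ) :
    ∃ M : FormalMultilinearSeries ℝ ℂ ℝ, IsComponents n k y M := by
  obtain ⟨M, h0, h1, h2⟩ := exists_components n hk y
  refine ⟨M, h0, h1, fun m x => ?_⟩
  have := congrArg (fun N : ContinuousMultilinearMap ℝ (fun _ : Fin (m + 1) => ℂ) ℝ =>
    N (fun _ => x)) (h2 m)
  simpa only [diagPoly, sub_apply, smul_apply,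
    mulForm_diag, reflSum_diag, smul_eq_mul] using this

variable {n : ℕ} {k : ℝ} {y : ℂ} {M : FormalMultilinearSeries ℝ ℂ ℝ}

/-- By Euler's identity the radial derivative is multiplication by the degree, so the recursion is
exactly the radial equation. -/
lemma IsComponents.radial (h : IsComponents n k y M) (m : ℕ) (x : ℂ) :
    dunklOp n k x (diagPoly (M (m + 1))) x = inner ℝ x y * diagPoly (M m) x := by
  rw [dunklOp_self, fderiv_diagPoly_self, ← h.succ]
  push_cast
  ring

lemma IsComponents.tangential (h : IsComponents n k y M) (hn : n ≠ 0) (hk : 0 < k) (m : ℕ)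
    (x : ℂ) : dunklOp n k (Complex.I * x) (diagPoly (M (m + 1))) x
      = inner ℝ (Complex.I * x) y * diagPoly (M m) x := by
  have hM0 : diagPoly (M 0) = fun _ => 1 := funext h.zero
  induction m generalizing x with
  | zero =>
    -- In degree zero `Q = 1`, and `(c - 1) - kn = 0` allows `Q' = 0`.
    refine tangential_step hn hk (c := (0 : ℕ) + 1 + n * k) (Q' := 0) (by simp; linarith) y
      (differentiable_diagPoly _) (differentiable_diagPoly _) (h.succ 0) (fun x => ?_)
      (fun x => ?_) x
    · simp [h.zero]; ring
    · rw [hM0, dunklOp_const]; simp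
  | succ m ih =>
    refine tangential_step hn hk (c := (m + 1 : ℕ) + 1 + n * k) (by push_cast; nlinarith) y
      (differentiable_diagPoly _) (differentiable_diagPoly _) (h.succ (m + 1)) (fun x => ?_)
      ih x
    rw [← h.succ m x]
    push_cast
    ring

/-- For `x ≠ 0` the vectors `x` and `I * x` form a real basis, and `dunklOp` is linear in `ξ`. -/
lemma IsComponents.eigen_of_ne_zero (h : IsComponents n k y M) (hn : n ≠ 0) (hk : 0 < k) (m : ℕ)
    {x : ℂ} (hx : x ≠ 0) (ξ : ℂ) :
    dunklOp n k ξ (diagPoly (M (m + 1))) x = inner ℝ ξ y * diagPoly (M m) x := by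
  have hξ : ξ = (ξ / x).re • x + (ξ / x).im • (Complex.I * x) := by
    have h1 := Complex.re_add_im (ξ / x)
    have h2 : ξ = (ξ / x) * x := by field_simp
    rw [Complex.real_smul, Complex.real_smul]
    calc ξ = (ξ / x) * x := h2
      _ = (((ξ / x).re : ℂ) + (ξ / x).im * Complex.I) * x := by rw [h1]
      _ = _ := by ring
  rw [hξ, dunklOp_add_left, dunklOp_smul_left, dunklOp_smul_left, h.radial, h.tangential hn hk,
    inner_add_left, inner_smul_left, inner_smul_left]
  simp
  ring

lemma IsComponents.summable_bound (h : IsComponents n k y M) (R : ℝ) (hR : 0 ≤ R) :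
    Summable fun m => ‖M m‖ * R ^ m := by
  refine Summable.of_nonneg_of_le (fun m => by positivity) (fun m => ?_)
    (Real.summable_pow_div_factorial (‖y‖ * R))
  calc ‖M m‖ * R ^ m ≤ ‖y‖ ^ m / (m.factorial : ℝ) * R ^ m := by gcongr; exact h.norm_le m
    _ = (‖y‖ * R) ^ m / (m.factorial : ℝ) := by rw [mul_pow]; ring

lemma IsComponents.summable (h : IsComponents n k y M) (x : ℂ) :
    Summable fun m => diagPoly (M m) x :=
  Summable.of_norm_bounded (h.summable_bound ‖x‖ (norm_nonneg _)) fun _ => abs_diagPoly_le _ _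

lemma IsComponents.summable_fderiv_bound (h : IsComponents n k y M) (R : ℝ) (hR : 0 ≤ R) :
    Summable fun m : ℕ => m * ‖M m‖ * R ^ (m - 1) := by
  rw [← summable_nat_add_iff 1]
  refine Summable.of_nonneg_of_le (fun m => by positivity) (fun m => ?_)
    ((Real.summable_pow_div_factorial (‖y‖ * R)).mul_left ‖y‖)
  calc ((m + 1 : ℕ) : ℝ) * ‖M (m + 1)‖ * R ^ (m + 1 - 1)
      ≤ ((m + 1 : ℕ) : ℝ) * (‖y‖ ^ (m + 1) / ((m + 1).factorial : ℝ)) * R ^ m := by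
        rw [Nat.add_sub_cancel]
        gcongr
        exact h.norm_le _
    _ = ‖y‖ * ((‖y‖ * R) ^ m / (m.factorial : ℝ)) := by
        rw [Nat.factorial_succ, mul_pow, pow_succ]; push_cast; field_simp

/-- The sum of the homogeneous components. -/
def componentSum (M : FormalMultilinearSeries ℝ ℂ ℝ) (x : ℂ) : ℝ := ∑' m, diagPoly (M m) x

lemma IsComponents.hasFPowerSeries (h : IsComponents n k y M) :
    HasFPowerSeriesOnBall (componentSum M) M 0 ⊤ := by
  have hr : M.radius = ⊤ := M.radius_eq_top_of_summable_norm fun r => h.summable_bound r r.2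
  have := M.hasFPowerSeriesOnBall (by rw [hr]; simp)
  rwa [hr] at this

lemma IsComponents.hasFDerivAt (h : IsComponents n k y M) (x : ℂ) :
    HasFDerivAt (componentSum M) (∑' m, fderiv ℝ (diagPoly (M m)) x) x := by
  refine hasFDerivAt_tsum_of_isPreconnected (s := Metric.ball (0 : ℂ) (‖x‖ + 1)) (x₀ := x)
    (h.summable_fderiv_bound (‖x‖ + 1) (by positivity)) Metric.isOpen_ball
    (convex_ball _ _).isPreconnected
    (fun m z _ => (differentiable_diagPoly (M m) z).hasFDerivAt) (fun m z hz => ?_)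
    (by simp) (h.summable x) (by simp)
  refine (norm_fderiv_diagPoly_le _ _).trans ?_
  have : ‖z‖ ≤ ‖x‖ + 1 := by simpa using (mem_ball_zero_iff.1 hz).le
  gcongr

lemma IsComponents.summable_fderiv (h : IsComponents n k y M) (x : ℂ) :
    Summable fun m => fderiv ℝ (diagPoly (M m)) x :=
  Summable.of_norm_bounded (h.summable_fderiv_bound ‖x‖ (norm_nonneg _)) fun _ =>
    norm_fderiv_diagPoly_le _ _

lemma IsComponents.hasSum_fderiv (h : IsComponents n k y M) (x ξ : ℂ) :
    HasSum (fun m => fderiv ℝ (diagPoly (M m)) x ξ) (fderiv ℝ (componentSum M) x ξ) := by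
  rw [(h.hasFDerivAt x).fderiv]
  exact ((ContinuousLinearMap.apply ℝ ℝ ξ).hasSum (h.summable_fderiv x).hasSum)

lemma IsComponents.hasSum_dunklOp (h : IsComponents n k y M) (ξ x : ℂ) :
    HasSum (fun m => dunklOp n k ξ (diagPoly (M m)) x) (dunklOp n k ξ (componentSum M) x) := by
  unfold dunklOp
  refine (h.hasSum_fderiv x ξ).add (HasSum.mul_left k (hasSum_sum fun j _ => HasSum.mul_left _ ?_))
  unfold diffQuot
  split_ifs
  · exact (h.hasSum_fderiv x _).mul_left 2
  · exact ((h.summable _).hasSum.sub (h.summable _).hasSum).div_const _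

/-- At the origin `x` and `I * x` no longer span, and every quotient takes its limiting value `2 ∂_α
f`. Only the linear component is seen, and the claim is the first step of the recursion. -/
lemma IsComponents.eigen_zero (h : IsComponents n k y M) (ξ : ℂ) :
    dunklOp n k ξ (componentSum M) 0 = inner ℝ ξ y * componentSum M 0 := by
  have hF : ∀ z, fderiv ℝ (componentSum M) 0 z = diagPoly (M 1) z := by
    intro z
    rw [h.hasFPowerSeries.hasFPowerSeriesAt.hasFDerivAt.fderiv]
    simp only [continuousMultilinearCurryFin1_apply]
    unfold diagPoly
    congr 1
  have h0 : componentSum M 0 = 1 := by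
    unfold componentSum
    rw [tsum_eq_single 0, h.zero]
    intro m hm
    have := diagPoly_smul (M m) 0 0
    simpa [hm] using this
  have hlin : ∀ α : ℂ, (inner ℝ α ξ : ℝ) * (2 * diagPoly (M 1) α)
      = diagPoly (M 1) ξ - diagPoly (M 1) (reflect α ξ) := by
    intro α
    have : ξ - reflect α ξ = (2 * inner ℝ α ξ : ℝ) • α := by simp [reflect]
    rw [← hF, ← hF, ← hF, ← map_sub, this, map_smul, smul_eq_mul]
    ring
  have hs := h.succ 0 ξ
  rw [h.zero] at hs
  unfold dunklOp diffQuot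
  simp only [inner_zero_right, if_true, hF, h0, hlin, Finset.sum_sub_distrib]
  simp only [Finset.sum_const, Finset.card_univ, Fintype.card_fin, nsmul_eq_mul]
  rw [← hs]
  push_cast
  ring

lemma IsComponents.isDunklEigenfunction (h : IsComponents n k y M) (hn : n ≠ 0) (hk : 0 < k) :
    IsDunklEigenfunction n k y (componentSum M) where
  analytic := fun x _ => h.hasFPowerSeries.analyticAt_of_mem (by simp)
  map_zero := by
    have := h.hasFPowerSeries.coeff_zero (fun _ => 0)
    rw [← this]
    exact h.zero 0
  eigen := by
    intro ξ x
    rcases eq_or_ne x 0 with rfl | hx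
    · exact h.eigen_zero ξ
    · have h1 := h.hasSum_dunklOp ξ x
      -- The operator kills the constant component and lowers degrees by one, hence the shift of the
      -- series.
      rw [← hasSum_nat_add_iff' 1] at h1
      simp only [h.eigen_of_ne_zero hn hk _ hx] at h1
      have hM0 : diagPoly (M 0) = fun _ => 1 := funext h.zero
      simp only [Finset.range_one, Finset.sum_singleton, hM0, dunklOp_const, sub_zero] at h1
      exact h1.unique ((h.summable x).hasSum.mul_left _)

end


/-! ### Uniqueness of the Dunkl kernel. -/

lemma norm_rotate (n : ℕ) (j : Fin n) (x : ℂ) : ‖rotate n j x‖ = ‖x‖ := by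
  rw [rotate_eq, norm_mul, norm_zeta, one_mul]

lemma rotate_smul (n : ℕ) (j : Fin n) (c : ℝ) (x : ℂ) :
    rotate n j (c • x) = c • rotate n j x := by
  rw [rotate_eq, rotate_eq, mul_smul_comm]

/-- A solution of the radial Dunkl equation vanishing at `0` vanishes: energy estimate over the
orbits of the group. -/
lemma eq_zero_of_radial {n : ℕ} (hn : n ≠ 0) {k : ℝ} (hk : 0 < k) (y : ℂ) {h : ℂ → ℝ}
    (hd : Differentiable ℝ h) (h0 : h 0 = 0)
    (hr : ∀ x, fderiv ℝ h x x + k * (n * h x - ∑ j : Fin n, h (reflect (root n j) x))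
      = inner ℝ x y * h x) (x : ℂ) : h x = 0 := by
  set r : Fin n → ℂ := fun j => rotate n j x with hrdef
  set s : Fin n → ℂ := fun j => reflect (root n j) x with hsdef
  have hcurve : ∀ (z : ℂ) (t : ℝ), HasDerivAt (fun t : ℝ => h (t • z) ^ 2)
      (2 * h (t • z) * fderiv ℝ h (t • z) z) t := by
    intro z t
    have h1 : HasDerivAt (fun t : ℝ => t • z) z t := by
      simpa using (hasDerivAt_id t).smul_const z
    have h2 := ((hd (t • z)).hasFDerivAt.comp_hasDerivAt t h1).pow 2
    refine h2.congr_deriv ?_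
    simp
  -- Taking squares over the whole orbit makes the reflection term a coupling of just the two coset
  -- sums `Sr` and `Ss`.
  set N : ℝ → ℝ := fun t => ∑ j, h (t • r j) ^ 2 + ∑ j, h (t • s j) ^ 2 with hN
  set N' : ℝ → ℝ := fun t => ∑ j, 2 * h (t • r j) * fderiv ℝ h (t • r j) (r j)
    + ∑ j, 2 * h (t • s j) * fderiv ℝ h (t • s j) (s j) with hN'
  have hNd : ∀ t, HasDerivAt N (N' t) t := fun t =>
    (HasDerivAt.fun_sum fun j _ => hcurve (r j) t).add
      (HasDerivAt.fun_sum fun j _ => hcurve (s j) t)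
  set C : ℝ := 2 * (‖x‖ * ‖y‖) with hC
  have hineq : ∀ t, 0 < t → N' t ≤ C * N t := by
    intro t ht
    -- The factor `t` turns the direction `z` into `t • z`, where the radial equation applies.
    have hmul : ∀ z, t * (2 * h (t • z) * fderiv ℝ h (t • z) z)
        = 2 * inner ℝ (t • z) y * h (t • z) ^ 2
          - 2 * k * (n * h (t • z) ^ 2
            - h (t • z) * ∑ j : Fin n, h (reflect (root n j) (t • z))) := by
      intro z
      have h1 := hr (t • z)
      rw [map_smul, smul_eq_mul] at h1
      linear_combination 2 * h (t • z) * h1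
    have hle : ∀ z, ‖z‖ = ‖x‖ → 2 * inner ℝ (t • z) y * h (t • z) ^ 2
        ≤ t * (C * h (t • z) ^ 2) := by
      intro z hz
      have h1 : (inner ℝ z y : ℝ) ≤ ‖x‖ * ‖y‖ := hz ▸ real_inner_le_norm z y
      rw [inner_smul_left]
      simp only [conj_trivial, hC]
      nlinarith [mul_le_mul_of_nonneg_left h1 (mul_nonneg ht.le (sq_nonneg (h (t • z))))]
    set Sr := ∑ j, h (t • r j) with hSr
    set Ss := ∑ j, h (t • s j) with hSs
    have hRr : ∀ i, ∑ j : Fin n, h (reflect (root n j) (t • r i)) = Ss := by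
      intro i
      simp only [hrdef, ← rotate_smul]
      rw [sum_reflect_rotate hn]
      simp only [hSs, hsdef, reflect_smul]
    have hRs : ∀ i, ∑ j : Fin n, h (reflect (root n j) (t • s i)) = Sr := by
      intro i
      simp only [hsdef, ← reflect_smul]
      rw [sum_reflect_reflect hn]
      simp only [hSr, hrdef, rotate_smul]
    have hcs1 : Sr ^ 2 ≤ n * ∑ j, h (t • r j) ^ 2 := by
      have := sq_sum_le_card_mul_sum_sq (s := Finset.univ) (f := fun j => h (t • r j))
      rwa [Finset.card_univ, Fintype.card_fin] at this
    have hcs2 : Ss ^ 2 ≤ n * ∑ j, h (t • s j) ^ 2 := by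
      have := sq_sum_le_card_mul_sum_sq (s := Finset.univ) (f := fun j => h (t • s j))
      rwa [Finset.card_univ, Fintype.card_fin] at this
    have h1 : t * N' t ≤ t * (C * N t) - 2 * k * (n * N t - 2 * (Sr * Ss)) := by
      simp only [hN', hN, mul_add, Finset.mul_sum]
      have e1 : ∑ j, t * (2 * h (t • r j) * fderiv ℝ h (t • r j) (r j))
          ≤ ∑ j, (t * (C * h (t • r j) ^ 2)
            - 2 * k * (n * h (t • r j) ^ 2 - h (t • r j) * Ss)) := by
        refine Finset.sum_le_sum fun j _ => ?_
        rw [hmul, hRr]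
        linarith [hle (r j) (norm_rotate n j x)]
      have e2 : ∑ j, t * (2 * h (t • s j) * fderiv ℝ h (t • s j) (s j))
          ≤ ∑ j, (t * (C * h (t • s j) ^ 2)
            - 2 * k * (n * h (t • s j) ^ 2 - h (t • s j) * Sr)) := by
        refine Finset.sum_le_sum fun j _ => ?_
        rw [hmul, hRs]
        linarith [hle (s j) (norm_reflect (norm_root n j) x)]
      refine (add_le_add e1 e2).trans (le_of_eq ?_)
      simp only [mul_sub, Finset.sum_sub_distrib, ← Finset.mul_sum, ← Finset.sum_mul, ← hSr,
        ← hSs]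
      ring
    -- By Cauchy–Schwarz `n N ≥ Sr² + Ss² ≥ 2 Sr Ss`, so for `k > 0` the reflection part only
    -- dissipates.
    have h2 : 0 ≤ 2 * k * (n * N t - 2 * (Sr * Ss)) := by
      refine mul_nonneg (by positivity) ?_
      simp only [hN, mul_add]
      nlinarith [sq_nonneg (Sr - Ss)]
    exact le_of_mul_le_mul_left (h1.trans (by linarith)) ht
  -- Grönwall: this function is nonincreasing from `N 0 = 0`, while `N` is nonnegative.
  have hanti : AntitoneOn (fun t => Real.exp (-(C * t)) * N t) (Set.Ici 0) := by
    have hder : ∀ t, HasDerivAt (fun t => Real.exp (-(C * t)) * N t)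
        (Real.exp (-(C * t)) * (-C) * N t + Real.exp (-(C * t)) * N' t) t := by
      intro t
      have h1 : HasDerivAt (fun t : ℝ => -(C * t)) (-C) t := by
        simpa using ((hasDerivAt_id t).const_mul C).fun_neg
      exact h1.exp.mul (hNd t)
    refine antitoneOn_of_deriv_nonpos (convex_Ici 0)
      (fun t _ => (hder t).continuousAt.continuousWithinAt)
      (fun t _ => (hder t).differentiableAt.differentiableWithinAt) fun t ht => ?_
    rw [interior_Ici] at ht
    rw [(hder t).deriv]
    nlinarith [mul_le_mul_of_nonneg_left (hineq t ht) (Real.exp_pos (-(C * t))).le]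
  have hN0 : N 0 = 0 := by simp [hN, h0]
  have h1 := hanti (Set.mem_Ici.2 le_rfl) (Set.mem_Ici.2 zero_le_one) zero_le_one
  simp only [hN0, mul_zero] at h1
  have h2 : N 1 ≤ 0 := nonpos_of_mul_nonpos_right h1 (Real.exp_pos _)
  have h3 : h (r ⟨0, Nat.pos_of_ne_zero hn⟩) ^ 2 ≤ ∑ j, h (r j) ^ 2 :=
    Finset.single_le_sum (f := fun j => h (r j) ^ 2) (fun j _ => sq_nonneg _) (Finset.mem_univ _)
  have h4 : 0 ≤ ∑ j, h (s j) ^ 2 := Finset.sum_nonneg fun j _ => sq_nonneg _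
  have h5 : r ⟨0, Nat.pos_of_ne_zero hn⟩ = x := by simp [hrdef, rotate]
  simp only [hN, one_smul] at h2
  rw [h5] at h3
  exact pow_eq_zero_iff two_ne_zero |>.1 (le_antisymm (by linarith) (sq_nonneg _))

lemma IsDunklEigenfunction.differentiable {n : ℕ} {k : ℝ} {y : ℂ} {f : ℂ → ℝ}
    (hf : IsDunklEigenfunction n k y f) : Differentiable ℝ f :=
  fun x => (hf.analytic x (Set.mem_univ x)).differentiableAt

lemma IsDunklEigenfunction.unique {n : ℕ} (hn : n ≠ 0) {k : ℝ} (hk : 0 < k) {y : ℂ} {f g : ℂ → ℝ}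
    (hf : IsDunklEigenfunction n k y f) (hg : IsDunklEigenfunction n k y g) : f = g := by
  funext x
  refine sub_eq_zero.1 (eq_zero_of_radial hn hk y (h := fun x => f x - g x)
    (hf.differentiable.sub hg.differentiable) (by simp [hf.map_zero, hg.map_zero])
    (fun x => ?_) x)
  have h1 := hf.eigen x x
  have h2 := hg.eigen x x
  rw [dunklOp_self] at h1 h2
  rw [fderiv_fun_sub (hf.differentiable x) (hg.differentiable x), sub_apply,
    Finset.sum_sub_distrib]
  linear_combination h1 - h2

/-- `dunklKernel` is an arbitrary choice among eigenfunctions; existence makes the choice meaningful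
and uniqueness identifies it. -/
lemma dunklKernel_eq {n : ℕ} (hn : n ≠ 0) {k : ℝ} (hk : 0 < k) {y : ℂ}
    {M : FormalMultilinearSeries ℝ ℂ ℝ} (hM : IsComponents n k y M) :
    dunklKernel n k y = componentSum M :=
  have h := hM.isDunklEigenfunction hn hk
  IsDunklEigenfunction.unique hn hk (Classical.epsilon_spec ⟨_, h⟩) h

lemma IsComponents.hasSum_generalizedBessel {n : ℕ} (hn : n ≠ 0) {k : ℝ} (hk : 0 < k) {y : ℂ}
    {M : FormalMultilinearSeries ℝ ℂ ℝ} (hM : IsComponents n k y M) (x : ℂ) :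
    HasSum (fun m => (1 / (2 * n : ℝ)) * (∑ j : Fin n, diagPoly (M m) (rotate n j x)
      + ∑ j : Fin n, diagPoly (M m) (reflect (root n j) x))) (generalizedBessel n k x y) := by
  unfold generalizedBessel
  rw [dunklKernel_eq hn hk hM]
  refine HasSum.mul_left _ ?_
  simp only [← Finset.sum_add_distrib]
  exact hasSum_sum fun j _ => (hM.summable _).hasSum.add (hM.summable _).hasSum


/-! ### Generating series of the orbit sums and the coupled first-order system. -/

section

open PowerSeries

/-- The geometric series `1 / (1 - cX)`. -/
def geom (c : ℝ) : PowerSeries ℝ := PowerSeries.mk fun m => c ^ m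

/-- The binomial series `(1 - cX) ^ (-a)`. -/
def binom (a c : ℝ) : PowerSeries ℝ :=
  PowerSeries.mk fun m => (ascPochhammer ℝ m).eval a * c ^ m / (m.factorial : ℝ)

lemma one_sub_mul_geom (c : ℝ) : (1 - C c * X) * geom c = 1 := by
  ext m
  rw [sub_mul, one_mul, mul_assoc, map_sub, coeff_C_mul]
  cases m with
  | zero => simp [geom]
  | succ m => rw [coeff_succ_X_mul]; simp [geom, coeff_one]; ring

lemma X_mul_geom (c : ℝ) : C c * X * geom c = geom c - 1 := by
  linear_combination -one_sub_mul_geom c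

lemma ascPochhammer_eval_pos {a : ℝ} (ha : 0 < a) (m : ℕ) : 0 < (ascPochhammer ℝ m).eval a := by
  induction m with
  | zero => simp
  | succ m ih => rw [ascPochhammer_succ_eval]; positivity

lemma ascPochhammer_succ_eval_left (a : ℝ) (m : ℕ) :
    (ascPochhammer ℝ (m + 1)).eval a = a * (ascPochhammer ℝ m).eval (a + 1) := by
  rw [ascPochhammer_succ_left]; simp

lemma one_sub_mul_derivative_binom (a c : ℝ) :
    (1 - C c * X) * derivative ℝ (binom a c) = C (a * c) * binom a c := by
  ext m
  rw [sub_mul, one_mul, mul_assoc, map_sub, coeff_C_mul, coeff_C_mul]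
  cases m with
  | zero => simp [binom, coeff_derivative]
  | succ m =>
    rw [coeff_succ_X_mul, coeff_derivative, coeff_derivative]
    simp only [binom, coeff_mk, ascPochhammer_succ_eval, Nat.factorial_succ]
    push_cast
    field_simp
    ring

lemma derivative_binom (a c : ℝ) :
    derivative ℝ (binom a c) = (C (a * c) * geom c) * binom a c := by
  linear_combination geom c * one_sub_mul_derivative_binom a c - derivative ℝ (binom a c) * one_sub_mul_geom c

lemma one_sub_mul_binom (a c : ℝ) : (1 - C c * X) * binom (a + 1) c = binom a c := by
  ext m
  rw [sub_mul, one_mul, mul_assoc, map_sub, coeff_C_mul]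
  cases m with
  | zero => simp [binom]
  | succ m =>
    rw [coeff_succ_X_mul]
    simp only [binom, coeff_mk, ascPochhammer_succ_eval_left a, Nat.factorial_succ,
      ascPochhammer_succ_eval m (a + 1)]
    push_cast
    field_simp
    ring

lemma derivative_prod_of_log {ι : Type*} (s : Finset ι) (f w : ι → PowerSeries ℝ)
    (h : ∀ i, derivative ℝ (f i) = w i * f i) :
    derivative ℝ (∏ i ∈ s, f i) = (∑ i ∈ s, w i) * ∏ i ∈ s, f i := by
  classical
  induction s using Finset.induction_on with
  | empty => simp
  | insert a s ha ih =>
    rw [Finset.prod_insert ha, Finset.sum_insert ha, Derivation.leibniz, ih, h, smul_eq_mul,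
      smul_eq_mul]
    ring

/-- The reversed polynomial `∏ (1 - lᵢ X)`. -/
def nodePoly {n : ℕ} (l : Fin n → ℝ) : PowerSeries ℝ := ∏ i, (1 - C (l i) * X)

/-- The sum `∑ 1 / (1 - lᵢ X)`. -/
def geomSum {n : ℕ} (l : Fin n → ℝ) : PowerSeries ℝ := ∑ i, geom (l i)

/-- The product `∏ (1 - lᵢ X) ^ (-a)`. -/
def binomProd {n : ℕ} (a : ℝ) (l : Fin n → ℝ) : PowerSeries ℝ := ∏ i, binom a (l i)

/-- The operator `a + X d/dX`. -/
def eulerOp (a : ℝ) (A : PowerSeries ℝ) : PowerSeries ℝ := C a * A + X * derivative ℝ A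

lemma eulerOp_add (a : ℝ) (A B : PowerSeries ℝ) :
    eulerOp a (A + B) = eulerOp a A + eulerOp a B := by
  simp only [eulerOp, map_add]; ring

lemma eulerOp_sub (a : ℝ) (A B : PowerSeries ℝ) :
    eulerOp a (A - B) = eulerOp a A - eulerOp a B := by
  simp only [eulerOp, map_sub]; ring

lemma eulerOp_C_mul (a c : ℝ) (A : PowerSeries ℝ) :
    eulerOp a (C c * A) = C c * eulerOp a A := by
  simp only [eulerOp, Derivation.leibniz, derivative_C, smul_eq_mul]; ring

lemma eulerOp_X_pow_mul (a : ℝ) (m : ℕ) (A : PowerSeries ℝ) :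
    eulerOp a (X ^ m * A) = X ^ m * eulerOp (a + m) A := by
  cases m with
  | zero => simp
  | succ m =>
    simp only [eulerOp, Derivation.leibniz, derivative_pow, derivative_X, smul_eq_mul, map_add,
      Nat.add_sub_cancel]
    push_cast
    rw [map_add, map_natCast, map_one]
    ring

lemma coeff_eulerOp (a : ℝ) (A : PowerSeries ℝ) (m : ℕ) :
    coeff m (eulerOp a A) = (a + m) * coeff m A := by
  rw [eulerOp, map_add, coeff_C_mul]
  cases m with
  | zero => simp
  | succ m => rw [coeff_succ_X_mul, coeff_derivative]; push_cast; ring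

variable {n : ℕ}

/-- A logarithmic derivative. The right side is linear in `nodePoly` and kills `X^n`, so `nodePoly l
* geomSum l` does not change when a multiple of `X^n` is added to `nodePoly l`. -/
lemma nodePoly_mul_geomSum (l : Fin n → ℝ) :
    nodePoly l * geomSum l = (n : PowerSeries ℝ) * nodePoly l - X * derivative ℝ (nodePoly l) := by
  have h : derivative ℝ (nodePoly l) = (∑ i, -C (l i) * geom (l i)) * nodePoly l :=
    derivative_prod_of_log _ _ _ fun i => by
      rw [map_sub, Derivation.leibniz, derivative_C, derivative_one, derivative_X, smul_eq_mul,
        smul_eq_mul]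
      linear_combination C (l i) * one_sub_mul_geom (l i)
  have h2 : X * ∑ i, -C (l i) * geom (l i) = (n : PowerSeries ℝ) - geomSum l := by
    rw [Finset.mul_sum, geomSum, eq_sub_iff_add_eq, ← Finset.sum_add_distrib]
    rw [Finset.sum_congr rfl (g := fun _ => (1 : PowerSeries ℝ))
      fun i _ => by linear_combination -X_mul_geom (l i)]
    simp
  rw [h]
  linear_combination (nodePoly l) * h2

/-- Logarithmic differentiation yields `∑ a lX/(1 - lX) = a ∑ 1/(1 - lX) - na`; the shift `na` of
the Euler operator cancels the constant. -/
lemma eulerOp_binomProd (a : ℝ) (l : Fin n → ℝ) :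
    eulerOp (n * a) (binomProd a l) = C a * geomSum l * binomProd a l := by
  have h : derivative ℝ (binomProd a l) = (∑ i, C (a * l i) * geom (l i)) * binomProd a l :=
    derivative_prod_of_log _ _ _ fun i => derivative_binom a (l i)
  have h2 : X * ∑ i, C (a * l i) * geom (l i) = C a * geomSum l - C (n * a) := by
    rw [Finset.mul_sum, geomSum, eq_sub_iff_add_eq, Finset.mul_sum,
      show C (n * a : ℝ) = ∑ _i : Fin n, C (a : ℝ) by simp, ← Finset.sum_add_distrib]
    refine Finset.sum_congr rfl fun i _ => ?_
    rw [map_mul]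
    linear_combination C a * X_mul_geom (l i)
  rw [eulerOp, h]
  linear_combination (binomProd a l) * h2

lemma nodePoly_mul_binomProd (a : ℝ) (l : Fin n → ℝ) :
    nodePoly l * binomProd (a + 1) l = binomProd a l := by
  unfold nodePoly binomProd
  rw [← Finset.prod_mul_distrib]
  exact Finset.prod_congr rfl fun i _ => one_sub_mul_binom a (l i)

lemma constantCoeff_nodePoly (l : Fin n → ℝ) : constantCoeff (nodePoly l) = 1 := by
  simp [nodePoly, map_prod]

lemma constantCoeff_geomSum (l : Fin n → ℝ) : constantCoeff (geomSum l) = n := by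
  simp [geomSum, map_sum, geom, ← coeff_zero_eq_constantCoeff_apply]

lemma constantCoeff_binomProd (a : ℝ) (l : Fin n → ℝ) : constantCoeff (binomProd a l) = 1 := by
  simp [binomProd, map_prod, binom, ← coeff_zero_eq_constantCoeff_apply]

lemma coeff_X_pow_mul_self (m : ℕ) (A : PowerSeries ℝ) :
    coeff m (X ^ m * A) = constantCoeff A := by
  have := coeff_X_pow_mul A m 0
  rw [zero_add] at this
  rw [this, coeff_zero_eq_constantCoeff_apply]

/-- Uniqueness of the solution of the coupled system for the two orbit sums. -/
lemma system_unique {k : ℝ} (hn : n ≠ 0) (hk : 0 < k) {u q v A B : PowerSeries ℝ} {L : ℕ}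
    (hu : constantCoeff u = n) (hq : constantCoeff q = 1)
    (hv : constantCoeff v = n) (hA0 : constantCoeff A = 0) (hB0 : constantCoeff B = 0)
    (h1 : X ^ L ∣ eulerOp (n * k) A - C k * u * B)
    (h2 : X ^ L ∣ q * eulerOp (n * k) B - C k * v * A) :
    ∀ m < L, coeff m A = 0 ∧ coeff m B = 0 := by
  have hn0 : (0 : ℝ) < n := by exact_mod_cast Nat.pos_of_ne_zero hn
  have key : ∀ m ≤ L, X ^ m ∣ A ∧ X ^ m ∣ B := by
    intro m
    induction m with
    | zero => intro _; simp
    | succ m ih =>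
      intro hm
      obtain ⟨⟨A', rfl⟩, ⟨B', rfl⟩⟩ := ih (by omega)
      suffices constantCoeff A' = 0 ∧ constantCoeff B' = 0 by
        rw [pow_succ]
        exact ⟨mul_dvd_mul_left _ (X_dvd_iff.2 this.1), mul_dvd_mul_left _ (X_dvd_iff.2 this.2)⟩
      -- The leading coefficients satisfy `(nk+m) α = nk β` and `(nk+m) β = nk α`, with determinant
      -- `m(2nk + m)`. It vanishes at `m = 0`, which is why the constant terms are prescribed.
      rcases Nat.eq_zero_or_pos m with rfl | hmpos
      · simpa using And.intro hA0 hB0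
      have hm0 : (0 : ℝ) < m := by exact_mod_cast hmpos
      have e1 := X_pow_dvd_iff.1 h1 m (by omega)
      have e2 := X_pow_dvd_iff.1 h2 m (by omega)
      rw [eulerOp_X_pow_mul, show X ^ m * eulerOp (n * k + m) A' - C k * u * (X ^ m * B')
        = X ^ m * (eulerOp (n * k + m) A' - C k * u * B') by ring, coeff_X_pow_mul_self] at e1
      rw [eulerOp_X_pow_mul, show q * (X ^ m * eulerOp (n * k + m) B') - C k * v * (X ^ m * A')
        = X ^ m * (q * eulerOp (n * k + m) B' - C k * v * A') by ring,
        coeff_X_pow_mul_self] at e2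
      have hE : ∀ Z : PowerSeries ℝ, constantCoeff (eulerOp (n * k + m) Z)
          = (n * k + m) * constantCoeff Z := fun Z => by
        rw [← coeff_zero_eq_constantCoeff_apply, coeff_eulerOp]; simp
      simp only [map_sub, map_mul, hE, constantCoeff_C, hu, hq, hv] at e1 e2
      set α := constantCoeff A'
      set β := constantCoeff B'
      have hc : 0 < n * k := by positivity
      have hs : m * (α + β) = 0 := by linear_combination e1 + e2
      have hs' : α + β = 0 := by rcases mul_eq_zero.1 hs with h | h <;> [linarith; exact h]
      have hd : (2 * (n * k) + m) * α = 0 := by linear_combination e1 + (n * k) * hs'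
      have hα : α = 0 := by
        rcases mul_eq_zero.1 hd with h | h
        · nlinarith
        · exact h
      exact ⟨hα, by linarith⟩
  intro m hm
  obtain ⟨hA, hB⟩ := key L le_rfl
  exact ⟨X_pow_dvd_iff.1 hA m hm, X_pow_dvd_iff.1 hB m hm⟩

/-- The coefficients `(k)_j² / ((2k)_j j!) (-δ)^j` of `₂F₁(k, k; 2k; -δ)`. -/
def hypCoeff (k δ : ℝ) (j : ℕ) : ℝ :=
  (ascPochhammer ℝ j).eval k ^ 2 / ((ascPochhammer ℝ j).eval (2 * k) * (j.factorial : ℝ)) * (-δ) ^ j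

lemma hypCoeff_succ {k : ℝ} (hk : 0 < k) (δ : ℝ) (j : ℕ) :
    (j + 1 : ℝ) * (2 * k + j) * hypCoeff k δ (j + 1) = -δ * (k + j) ^ 2 * hypCoeff k δ j := by
  unfold hypCoeff
  have h1 := (ascPochhammer_eval_pos (show 0 < 2 * k by linarith) j).ne'
  have h2 : (2 * k + j : ℝ) ≠ 0 := by positivity
  rw [ascPochhammer_succ_eval, ascPochhammer_succ_eval, Nat.factorial_succ]
  push_cast
  field_simp
  ring

/-- Truncations of the explicit solution of the coupled system. -/
def partialSol (l : Fin n → ℝ) (k : ℝ) (a : ℕ → ℝ) (J : ℕ) : PowerSeries ℝ :=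
  ∑ j ∈ Finset.range J, C (a j) * (X ^ (n * j) * binomProd (k + j) l)

lemma eulerOp_term (l : Fin n → ℝ) (k : ℝ) (j : ℕ) :
    eulerOp (n * k) (X ^ (n * j) * binomProd (k + j) l)
      = C (k + j) * geomSum l * (X ^ (n * j) * binomProd (k + j) l) := by
  rw [eulerOp_X_pow_mul, show (n * k + (n * j : ℕ) : ℝ) = n * (k + j) by push_cast; ring,
    eulerOp_binomProd]
  ring

/-- The first equation holds term by term, so truncation leaves no remainder. -/
lemma partialSol_eq_fst (l : Fin n → ℝ) (k : ℝ) {a b : ℕ → ℝ}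
    (hab : ∀ j : ℕ, (k + j) * a j = k * b j) (J : ℕ) :
    eulerOp (n * k) (partialSol l k a J) = C k * geomSum l * partialSol l k b J := by
  induction J with
  | zero => simp [partialSol, eulerOp]
  | succ J ih =>
    rw [partialSol, Finset.sum_range_succ, eulerOp_add, ← partialSol, ih, eulerOp_C_mul,
      eulerOp_term, partialSol, partialSol, Finset.sum_range_succ, mul_add]
    have := congrArg (C (R := ℝ)) (hab J)
    rw [map_mul, map_mul] at this
    linear_combination (geomSum l * (X ^ (n * J) * binomProd (k + J) l)) * this

/-- After multiplication by `nodePoly l'`, the part `δ X^n` carries the `j`-th term to the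
`(j+1)`-st, as `binomProd (k+j) l = nodePoly l * binomProd (k+j+1) l`. Consecutive terms match by
`hab`, leaving one remainder of order `n(J+1)`. -/
lemma partialSol_eq_snd (l l' : Fin n → ℝ) (k δ : ℝ) (hl : nodePoly l' = nodePoly l + C δ * X ^ n)
    {a b : ℕ → ℝ} (h0 : b 0 = a 0)
    (hab : ∀ j : ℕ, (k + (j + 1 : ℕ)) * b (j + 1) + δ * (k + j) * b j = k * a (j + 1)) (J : ℕ) :
    nodePoly l' * eulerOp (n * k) (partialSol l k b (J + 1))
      = C k * (nodePoly l * geomSum l) * partialSol l k a (J + 1)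
        + C (δ * (k + J) * b J) * (nodePoly l * geomSum l)
          * (X ^ (n * (J + 1)) * binomProd (k + (J + 1 : ℕ)) l) := by
  have hterm : ∀ j : ℕ, nodePoly l' * eulerOp (n * k) (X ^ (n * j) * binomProd (k + j) l)
      = C (k + j) * (nodePoly l * geomSum l) * (X ^ (n * j) * binomProd (k + j) l)
        + C (δ * (k + j)) * (nodePoly l * geomSum l)
          * (X ^ (n * (j + 1)) * binomProd (k + (j + 1 : ℕ)) l) := by
    intro j
    have h1 := nodePoly_mul_binomProd (k + j) l
    rw [show k + j + 1 = k + (j + 1 : ℕ) by push_cast; ring] at h1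
    rw [eulerOp_term, hl, mul_add n, mul_one, pow_add, map_mul C δ]
    linear_combination (-(C δ * C (k + j) * geomSum l * X ^ (n * j) * X ^ n)) * h1
  induction J with
  | zero =>
    simp only [partialSol, zero_add, Finset.sum_range_one, eulerOp_C_mul]
    rw [mul_left_comm, hterm 0, ← h0, map_mul C (δ * _)]
    simp only [Nat.cast_zero, add_zero, zero_add]
    ring
  | succ J ih =>
    rw [partialSol, Finset.sum_range_succ, eulerOp_add, mul_add, ← partialSol, ih, eulerOp_C_mul,
      mul_left_comm (nodePoly l') (C (b (J + 1))), hterm (J + 1), partialSol, partialSol, Finset.sum_range_succ _ (J + 1)]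
    have := congrArg (C (R := ℝ)) (hab J)
    rw [map_mul C k, map_add, map_mul C _ (b (J + 1))] at this
    rw [map_mul C _ (b (J + 1))]
    linear_combination
      (nodePoly l * geomSum l * (X ^ (n * (J + 1)) * binomProd (k + (J + 1 : ℕ)) l)) * this

/-- The coefficients of the sum of the two components of a solution of the coupled system. -/
lemma coeff_add_of_system {k δ : ℝ} (hn : n ≠ 0) (hk : 0 < k) (l l' : Fin n → ℝ)
    (hl : nodePoly l' = nodePoly l + C δ * X ^ n) {A B : PowerSeries ℝ}
    (hA0 : constantCoeff A = n) (hB0 : constantCoeff B = n)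
    (h1 : eulerOp (n * k) A = C k * geomSum l * B)
    (h2 : eulerOp (n * k) B = C k * geomSum l' * A) (m : ℕ) :
    coeff m A + coeff m B = 2 * n * ∑ j ∈ Finset.range (m + 1),
      hypCoeff k δ j * coeff m (X ^ (n * j) * binomProd (k + j) l) := by
  -- `a` and `b` are forced by `(k+j) a_j = k b_j` from the first equation and `a_j + b_j = 2n ·
  -- hypCoeff k δ j`.
  set b : ℕ → ℝ := fun j => 2 * n * hypCoeff k δ j * (k + j) / (2 * k + j) with hb
  set a : ℕ → ℝ := fun j => 2 * n * hypCoeff k δ j * k / (2 * k + j) with ha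
  have hpos : ∀ j : ℕ, (2 * k + j : ℝ) ≠ 0 := fun j => by positivity
  have hsum : ∀ j, a j + b j = 2 * n * hypCoeff k δ j := fun j => by
    simp only [ha, hb]; rw [← add_div, div_eq_iff (hpos j)]; ring
  have hab1 : ∀ j : ℕ, (k + j) * a j = k * b j := fun j => by
    simp only [ha, hb]; ring
  have hab2 : ∀ j : ℕ, (k + (j + 1 : ℕ)) * b (j + 1) + δ * (k + j) * b j = k * a (j + 1) := by
    intro j
    have h := hypCoeff_succ hk δ j
    have e1 : (k + (j + 1 : ℕ)) * b (j + 1) - k * a (j + 1)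
        = 2 * n * ((j + 1 : ℝ) * hypCoeff k δ (j + 1)) := by
      simp only [ha, hb]
      rw [mul_div_assoc', mul_div_assoc', ← sub_div, div_eq_iff (hpos _)]
      push_cast
      ring
    have e2 : δ * (k + j) * b j = -(2 * n * ((j + 1 : ℝ) * hypCoeff k δ (j + 1))) := by
      simp only [hb]
      rw [mul_div_assoc', div_eq_iff (hpos _)]
      linear_combination (2 * n : ℝ) * h
    linear_combination e1 + e2
  have hc0 : hypCoeff k δ 0 = 1 := by simp [hypCoeff]
  have ha0 : a 0 = n := by simp only [ha, hc0, Nat.cast_zero]; field_simp; ring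
  have hb0 : b 0 = n := by simp only [hb, hc0, Nat.cast_zero]; field_simp; ring
  have hN : nodePoly l' * geomSum l' = nodePoly l * geomSum l := by
    rw [nodePoly_mul_geomSum, nodePoly_mul_geomSum, hl, map_add, Derivation.leibniz,
      derivative_C, derivative_pow, derivative_X, smul_eq_mul, smul_zero, add_zero]
    have hX : X * X ^ (n - 1) = (X : PowerSeries ℝ) ^ n := mul_pow_sub_one hn X
    linear_combination (-(C δ * (n : PowerSeries ℝ))) * hX
  set A' := partialSol l k a (m + 1) with hA'
  set B' := partialSol l k b (m + 1) with hB'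
  have hconst : ∀ c : ℕ → ℝ, constantCoeff (partialSol l k c (m + 1)) = c 0 := by
    intro c
    rw [partialSol, map_sum, Finset.sum_range_succ',
      Finset.sum_eq_zero fun j _ => by simp [hn]]
    simp [constantCoeff_binomProd]
  have hu := system_unique (L := m + 1) (u := geomSum l) (q := nodePoly l')
    (v := nodePoly l * geomSum l) (A := A - A') (B := B - B') hn hk (constantCoeff_geomSum l)
    (constantCoeff_nodePoly l') (by rw [map_mul, constantCoeff_nodePoly, constantCoeff_geomSum,
      one_mul]) (by rw [map_sub, hA0, hconst, ha0, sub_self])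
    (by rw [map_sub, hB0, hconst, hb0, sub_self])
    (by rw [eulerOp_sub, h1, partialSol_eq_fst l k hab1]; simp [← mul_sub, hB'])
    (by
      rw [eulerOp_sub, mul_sub, h2, partialSol_eq_snd l l' k δ hl (hb0.trans ha0.symm) hab2]
      -- The truncation remainder has order `n(m+1) ≥ m+1` and cannot affect the coefficient of
      -- `X^m`.
      refine Dvd.dvd.trans (pow_dvd_pow X (show m + 1 ≤ n * (m + 1) from
        Nat.le_mul_of_pos_left _ (Nat.pos_of_ne_zero hn))) ⟨-(C (δ * (k + m) * b m) *
          (nodePoly l * geomSum l) * binomProd (k + (m + 1 : ℕ)) l), ?_⟩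
      linear_combination (C k * A) * hN) m (Nat.lt_succ_self m)
  have hAm : coeff m A = coeff m A' := by
    have := hu.1; rw [map_sub] at this; linarith
  have hBm : coeff m B = coeff m B' := by
    have := hu.2; rw [map_sub] at this; linarith
  rw [hAm, hBm, hA', hB', partialSol, partialSol, map_sum, map_sum, ← Finset.sum_add_distrib,
    Finset.mul_sum]
  refine Finset.sum_congr rfl fun j _ => ?_
  rw [coeff_C_mul, coeff_C_mul, ← add_mul, hsum]
  ring

/-- The generating series of the values of the homogeneous components over half of an orbit. -/
lemma eulerOp_orbitSum {k : ℝ} {c d : ℕ → ℝ} (p : ℕ → Fin n → ℝ) (l : Fin n → ℝ)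
    (hp0 : ∀ i, p 0 i = 1) (hd0 : d 0 = n) (hc : ∀ m, c m = ∑ i, p m i)
    (hrec : ∀ (m : ℕ) (i : Fin n), (m + 1 + n * k : ℝ) * p (m + 1) i - k * d (m + 1) = l i * p m i) :
    eulerOp (n * k) (PowerSeries.mk fun m => (ascPochhammer ℝ m).eval (n * k) * c m)
      = C k * geomSum l * PowerSeries.mk fun m => (ascPochhammer ℝ m).eval (n * k) * d m := by
  -- The weight `(nk)_{m+1} = (nk)_m (nk+m)` absorbs the factor `m+1+nk` of the recursion, which
  -- becomes `(1 - l_i X) S_i = k B`; summing the `S_i` gives the Euler operator.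
  set S : Fin n → PowerSeries ℝ := fun i =>
    PowerSeries.mk fun m => (ascPochhammer ℝ (m + 1)).eval (n * k) * p m i with hS
  set B : PowerSeries ℝ := PowerSeries.mk fun m => (ascPochhammer ℝ m).eval (n * k) * d m with hB
  have h1 : ∀ i, (1 - C (l i) * X) * S i = C k * B := by
    intro i
    ext m
    rw [sub_mul, one_mul, mul_assoc, map_sub, coeff_C_mul, coeff_C_mul]
    cases m with
    | zero => simp [hS, hB, hp0, hd0, mul_comm]
    | succ m =>
      rw [coeff_succ_X_mul]
      simp only [hS, hB, coeff_mk, ascPochhammer_succ_eval (m + 1)]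
      push_cast
      linear_combination (ascPochhammer ℝ (m + 1)).eval (n * k) * hrec m i
  have h2 : ∀ i, S i = C k * geom (l i) * B := fun i => by
    linear_combination geom (l i) * h1 i - S i * one_sub_mul_geom (l i)
  have h3 : eulerOp (n * k) (PowerSeries.mk fun m => (ascPochhammer ℝ m).eval (n * k) * c m)
      = ∑ i, S i := by
    ext m
    rw [coeff_eulerOp, map_sum]
    simp only [hS, coeff_mk, ← Finset.mul_sum, ← hc, ascPochhammer_succ_eval]
    ring
  rw [h3, geomSum, Finset.mul_sum, Finset.sum_mul]
  exact Finset.sum_congr rfl fun i _ => h2 i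

/-- The homogeneous components of the generalized Bessel function. -/
lemma IsComponents.orbit_sum_eq {k δ : ℝ} {y : ℂ} {M : FormalMultilinearSeries ℝ ℂ ℝ}
    (hM : IsComponents n k y M) (hn : n ≠ 0) (hk : 0 < k) (x : ℂ) (l : Fin n → ℝ)
    (hl : nodePoly (fun j : Fin n => inner ℝ (rotate n j x) y) = nodePoly l)
    (hl' : nodePoly (fun j : Fin n => inner ℝ (reflect (root n j) x) y)
      = nodePoly l + C δ * X ^ n) (m : ℕ) :
    (1 / (2 * n : ℝ)) * (∑ j : Fin n, diagPoly (M m) (rotate n j x)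
      + ∑ j : Fin n, diagPoly (M m) (reflect (root n j) x))
      = (∑ j ∈ Finset.range (m + 1), hypCoeff k δ j * coeff m (X ^ (n * j) * binomProd (k + j) l))
          / (ascPochhammer ℝ m).eval (n * k) := by
  set lr : Fin n → ℝ := fun j => inner ℝ (rotate n j x) y with hlr
  set ls : Fin n → ℝ := fun j => inner ℝ (reflect (root n j) x) y with hls
  set c : ℕ → ℝ := fun m => ∑ j : Fin n, diagPoly (M m) (rotate n j x) with hc
  set d : ℕ → ℝ := fun m => ∑ j : Fin n, diagPoly (M m) (reflect (root n j) x) with hd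
  have hc0 : c 0 = n := by simp [hc, hM.zero]
  have hd0 : d 0 = n := by simp [hd, hM.zero]
  have e1 := eulerOp_orbitSum (k := k) (c := c) (d := d)
    (fun m j => diagPoly (M m) (rotate n j x)) lr (fun _ => hM.zero _) hd0 (fun _ => rfl)
    (fun m j => by
      have h := hM.succ m (rotate n j x)
      rwa [sum_reflect_rotate hn] at h)
  have e2 := eulerOp_orbitSum (k := k) (c := d) (d := c)
    (fun m j => diagPoly (M m) (reflect (root n j) x)) ls (fun _ => hM.zero _) hc0 (fun _ => rfl)
    (fun m j => by
      have h := hM.succ m (reflect (root n j) x)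
      rwa [sum_reflect_reflect hn] at h)
  -- Only the node polynomials are known to agree, not the indexed nodes; `nodePoly_mul_geomSum`
  -- recovers `geomSum` by cancellation.
  have hgl : geomSum lr = geomSum l := by
    have h1 := nodePoly_mul_geomSum lr
    rw [hl, ← nodePoly_mul_geomSum] at h1
    refine mul_left_cancel₀ (fun h => ?_) h1
    have := constantCoeff_nodePoly l
    rw [h, map_zero] at this
    exact zero_ne_one this
  rw [hgl] at e1
  have key := coeff_add_of_system hn hk l ls hl'
    (by simp [← coeff_zero_eq_constantCoeff_apply, hc0])
    (by simp [← coeff_zero_eq_constantCoeff_apply, hd0]) e1 e2 m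
  rw [coeff_mk, coeff_mk, ← mul_add] at key
  have hn0 : (n : ℝ) ≠ 0 := by exact_mod_cast hn
  have hpos : 0 < (ascPochhammer ℝ m).eval (n * k : ℝ) := ascPochhammer_eval_pos (by positivity) m
  rw [eq_div_iff hpos.ne', one_div_mul_eq_div, div_mul_eq_mul_div, div_eq_iff (by positivity)]
  linear_combination key

end


/-! ### The node polynomials of the two cosets and a Chebyshev identity. -/

lemma prod_sub_zeta {n : ℕ} (hn : n ≠ 0) (w c : ℂ) :
    ∏ s : Fin n, (w - c * zeta n ((s : ℕ) : ℤ)) = w ^ n - c ^ n := by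
  have hprim := Complex.isPrimitiveRoot_exp n hn
  have h := X_pow_sub_C_eq_prod hprim (Nat.pos_of_ne_zero hn) (rfl : c ^ n = c ^ n)
  have h2 := congrArg (Polynomial.eval w) h
  rw [Polynomial.eval_prod] at h2
  simp only [Polynomial.eval_sub, Polynomial.eval_pow, Polynomial.eval_X, Polynomial.eval_C] at h2
  rw [h2, Finset.prod_range]
  refine Finset.prod_congr rfl fun s _ => ?_
  rw [zeta, ← Complex.exp_nat_mul, mul_comm c]
  congr 3
  push_cast
  ring

lemma cos_node (n : ℕ) (ψ : ℝ) (s : ℕ) :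
    Complex.cos ((ψ + 2 * Real.pi * s / n : ℝ) : ℂ)
      = (Complex.exp (ψ * Complex.I) * zeta n (s : ℤ)
        + (Complex.exp (ψ * Complex.I) * zeta n (s : ℤ))⁻¹) / 2 := by
  have : Complex.exp (ψ * Complex.I) * zeta n (s : ℤ)
      = Complex.exp (((ψ + 2 * Real.pi * s / n : ℝ) : ℂ) * Complex.I) := by
    rw [zeta, ← Complex.exp_add]
    congr 1
    push_cast
    ring
  rw [this, ← Complex.exp_neg, Complex.cos]
  congr 3
  ring

/-- With `w = e^{iτ}`, `u = e^{iψ}` each factor is `(w - uζ^s)(w - u⁻¹ζ^{-s})/(2w)`, and both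
products are factorizations of `w^n - c^n`. -/
lemma prod_cos_sub_cos {n : ℕ} (hn : n ≠ 0) (τ : ℂ) (ψ : ℝ) :
    ∏ s : Fin n, (Complex.cos τ - Complex.cos ((ψ + 2 * Real.pi * (s : ℕ) / n : ℝ) : ℂ))
      = 2 * (Complex.cos (n * τ) - Complex.cos (n * ψ)) / 2 ^ n := by
  set w := Complex.exp (τ * Complex.I) with hw
  set u := Complex.exp (ψ * Complex.I) with hu
  have hw0 : w ≠ 0 := Complex.exp_ne_zero _
  have hu0 : u ≠ 0 := Complex.exp_ne_zero _
  have hz0 : ∀ j, zeta n j ≠ 0 := fun j => Complex.exp_ne_zero _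
  have hcos : ∀ z : ℂ, Complex.cos (n * z)
      = (Complex.exp (z * Complex.I) ^ n + (Complex.exp (z * Complex.I) ^ n)⁻¹) / 2 := by
    intro z
    rw [Complex.cos, ← Complex.exp_nat_mul, ← Complex.exp_neg]
    congr 3 <;> ring
  have hcos1 : Complex.cos τ = (w + w⁻¹) / 2 := by
    rw [hw, Complex.cos, ← Complex.exp_neg]
    congr 3
    ring
  have hfac : ∀ s : Fin n, Complex.cos τ - Complex.cos ((ψ + 2 * Real.pi * (s : ℕ) / n : ℝ) : ℂ)
      = (w - u * zeta n ((s : ℕ) : ℤ)) * (w - u⁻¹ * zeta n (0 - ((s : ℕ) : ℤ))) * (2 * w)⁻¹ := by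
    intro s
    have hinv : zeta n (0 - ((s : ℕ) : ℤ)) = (zeta n ((s : ℕ) : ℤ))⁻¹ :=
      eq_inv_of_mul_eq_one_left (by rw [← zeta_add, sub_add_cancel, zeta_zero])
    have := hz0 ((s : ℕ) : ℤ)
    rw [cos_node, hcos1, ← hu, hinv]
    field_simp
    ring
  have hneg : ∏ s : Fin n, (w - u⁻¹ * zeta n (0 - ((s : ℕ) : ℤ))) = w ^ n - u⁻¹ ^ n := by
    rw [← prod_sub_zeta hn]
    exact sum_periodic_sub hn (M := Additive ℂ)
      (fun j => Additive.ofMul (w - u⁻¹ * zeta n j)) (fun j => by rw [zeta_add_n hn]) 0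
  rw [Finset.prod_congr rfl fun s _ => hfac s, Finset.prod_mul_distrib, Finset.prod_mul_distrib,
    prod_sub_zeta hn, hneg, hcos, hcos, ← hw, ← hu]
  simp only [Finset.prod_const, Finset.card_univ, Fintype.card_fin, inv_pow, mul_pow]
  field_simp
  ring

/-- After the substitution `cos τ = 1/(Lt)` the product depends on `ψ` only through `cos(nψ)`,
multiplied by a multiple of `t^n`. -/
lemma prod_one_sub_cos {n : ℕ} (hn : n ≠ 0) (L t ψ ψ' : ℝ) :
    ∏ s : Fin n, (1 - L * Real.cos (ψ' + 2 * Real.pi * (s : ℕ) / n) * t)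
      = ∏ s : Fin n, (1 - L * Real.cos (ψ + 2 * Real.pi * (s : ℕ) / n) * t)
        + 2 * (L / 2) ^ n * (Real.cos (n * ψ) - Real.cos (n * ψ')) * t ^ n := by
  rcases eq_or_ne (L * t) 0 with h0 | h0
  · have h1 : ∀ c, 1 - L * c * t = 1 := fun c => by linear_combination (-c) * h0
    have h2 : (L / 2) ^ n * t ^ n = 0 := by
      rw [← mul_pow, show L / 2 * t = 0 by linear_combination (1 / 2) * h0, zero_pow hn]
    simp only [h1]
    linear_combination (-2 * (Real.cos (n * ψ) - Real.cos (n * ψ'))) * h2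
  -- `1/(Lt)` may lie outside `[-1, 1]`, so `τ` has to be complex.
  · obtain ⟨τ, hτ⟩ := Complex.cos_surjective ((L * t : ℝ) : ℂ)⁻¹
    have h0' : ((L * t : ℝ) : ℂ) ≠ 0 := by exact_mod_cast h0
    have key : ∀ ψ : ℝ, ((∏ s : Fin n, (1 - L * Real.cos (ψ + 2 * Real.pi * (s : ℕ) / n) * t) : ℝ)
        : ℂ) = ((L * t : ℝ) : ℂ) ^ n *
          (2 * (Complex.cos (n * τ) - Complex.cos (n * ψ)) / 2 ^ n) := by
      intro ψ
      rw [← prod_cos_sub_cos hn, hτ, Complex.ofReal_prod, show ((L * t : ℝ) : ℂ) ^ n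
        = ∏ _s : Fin n, ((L * t : ℝ) : ℂ) by simp, ← Finset.prod_mul_distrib]
      refine Finset.prod_congr rfl fun s _ => ?_
      rw [mul_sub, mul_inv_cancel₀ h0', ← Complex.ofReal_cos]
      push_cast
      ring
    apply Complex.ofReal_injective
    rw [Complex.ofReal_add, key, key]
    push_cast
    rw [mul_pow, div_pow]
    field_simp
    ring

lemma nodePoly_cos {n : ℕ} (hn : n ≠ 0) (L ψ ψ' : ℝ) :
    nodePoly (fun s : Fin n => L * Real.cos (ψ' + 2 * Real.pi * (s : ℕ) / n))
      = nodePoly (fun s : Fin n => L * Real.cos (ψ + 2 * Real.pi * (s : ℕ) / n))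
        + PowerSeries.C (2 * (L / 2) ^ n * (Real.cos (n * ψ) - Real.cos (n * ψ')))
          * PowerSeries.X ^ n := by
  have hcoe : ∀ l : Fin n → ℝ, nodePoly l
      = ((∏ i, (1 - Polynomial.C (l i) * Polynomial.X) : Polynomial ℝ) : PowerSeries ℝ) := by
    intro l
    rw [nodePoly, ← Polynomial.coeToPowerSeries.ringHom_apply, map_prod]
    simp
  have hpoly : (∏ s : Fin n, (1 - Polynomial.C (L * Real.cos (ψ' + 2 * Real.pi * (s : ℕ) / n))
        * Polynomial.X) : Polynomial ℝ)
      = ∏ s : Fin n, (1 - Polynomial.C (L * Real.cos (ψ + 2 * Real.pi * (s : ℕ) / n))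
        * Polynomial.X) + Polynomial.C (2 * (L / 2) ^ n * (Real.cos (n * ψ) - Real.cos (n * ψ')))
          * Polynomial.X ^ n := by
    refine Polynomial.funext fun t => ?_
    simp only [Polynomial.eval_add, Polynomial.eval_prod, Polynomial.eval_sub, Polynomial.eval_one,
      Polynomial.eval_mul, Polynomial.eval_C, Polynomial.eval_X, Polynomial.eval_pow]
    exact prod_one_sub_cos hn L t ψ ψ'
  rw [hcoe, hcoe, hpoly]
  simp

lemma inner_polar (a b α β : ℝ) :
    inner ℝ ((a : ℂ) * Complex.exp ((α : ℂ) * Complex.I)) ((b : ℂ) * Complex.exp ((β : ℂ) * Complex.I))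
      = a * b * Real.cos (α - β) := by
  rw [inner_eq_re]
  simp only [map_mul, Complex.conj_ofReal, ← Complex.exp_conj, Complex.conj_I]
  rw [show (a : ℂ) * Complex.exp (α * -Complex.I) * (b * Complex.exp (β * Complex.I))
      = ((a * b : ℝ) : ℂ) * (Complex.exp (α * -Complex.I) * Complex.exp (β * Complex.I)) by
        push_cast; ring, ← Complex.exp_add,
    show (α * -Complex.I + β * Complex.I : ℂ) = ((β - α : ℝ) : ℂ) * Complex.I by push_cast; ring,
    Complex.re_ofReal_mul, Complex.exp_ofReal_mul_I_re, ← Real.cos_neg (α - β), neg_sub]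

lemma inner_rotate_polar (n : ℕ) (ρ φ r θ : ℝ) (j : Fin n) :
    inner ℝ (rotate n j ((ρ : ℂ) * Complex.exp ((φ : ℂ) * Complex.I)))
      ((r : ℂ) * Complex.exp ((θ : ℂ) * Complex.I))
      = ρ * r * Real.cos ((φ - θ) + 2 * Real.pi * (j : ℕ) / n) := by
  have : rotate n j ((ρ : ℂ) * Complex.exp ((φ : ℂ) * Complex.I))
      = (ρ : ℂ) * Complex.exp (((φ + 2 * Real.pi * (j : ℕ) / n : ℝ) : ℂ) * Complex.I) := by
    rw [rotate, mul_left_comm, ← Complex.exp_add]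
    congr 2
    push_cast
    ring
  rw [this, inner_polar]
  congr 2
  ring

lemma inner_reflect_polar (n : ℕ) (ρ φ r θ : ℝ) (j : Fin n) :
    inner ℝ (reflect (root n j) ((ρ : ℂ) * Complex.exp ((φ : ℂ) * Complex.I)))
      ((r : ℂ) * Complex.exp ((θ : ℂ) * Complex.I))
      = ρ * r * Real.cos ((-(φ + θ) + 2 * Real.pi / n) + 2 * Real.pi * (j : ℕ) / n) := by
  have : reflect (root n j) ((ρ : ℂ) * Complex.exp ((φ : ℂ) * Complex.I))
      = (ρ : ℂ) * Complex.exp (((-φ + 2 * Real.pi / n + 2 * Real.pi * (j : ℕ) / n : ℝ) : ℂ)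
        * Complex.I) := by
    rw [reflect_root, zeta, map_mul, Complex.conj_ofReal, ← Complex.exp_conj, map_mul,
      Complex.conj_ofReal, Complex.conj_I, mul_left_comm, ← Complex.exp_add]
    congr 2
    push_cast
    ring
  rw [this, inner_polar]
  congr 2
  ring

/-- The nodes `ρ r cos (θ - φ + 2πs/n)` of the linear form in the exponent. -/
def nodes (n : ℕ) (ρ φ r θ : ℝ) (s : Fin n) : ℝ := ρ * r * b n (θ - φ) (s : ℕ)

lemma nodePoly_rotate {n : ℕ} (hn : n ≠ 0) (ρ φ r θ : ℝ) :
    nodePoly (fun j : Fin n => inner ℝ (rotate n j ((ρ : ℂ) * Complex.exp ((φ : ℂ) * Complex.I)))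
      ((r : ℂ) * Complex.exp ((θ : ℂ) * Complex.I))) = nodePoly (nodes n ρ φ r θ) := by
  simp only [inner_rotate_polar]
  rw [nodePoly_cos hn _ (θ - φ)]
  rw [show Real.cos (n * (φ - θ)) = Real.cos (n * (θ - φ)) by rw [← Real.cos_neg]; congr 1; ring]
  simp
  rfl

/-- The offset `2π/n` disappears after multiplication by `n`, and `cos(nθ - nφ) - cos(nθ + nφ) = 2
sin(nθ) sin(nφ)` produces `δ`. -/
lemma nodePoly_reflect {n : ℕ} (hn : n ≠ 0) (ρ φ r θ : ℝ) :
    nodePoly (fun j : Fin n => inner ℝ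
      (reflect (root n j) ((ρ : ℂ) * Complex.exp ((φ : ℂ) * Complex.I)))
      ((r : ℂ) * Complex.exp ((θ : ℂ) * Complex.I))) = nodePoly (nodes n ρ φ r θ)
        + PowerSeries.C (4 * (ρ * r / 2) ^ n * Real.sin (n * θ) * Real.sin (n * φ))
          * PowerSeries.X ^ n := by
  have hn0 : (n : ℝ) ≠ 0 := by exact_mod_cast hn
  simp only [inner_reflect_polar]
  rw [nodePoly_cos hn _ (θ - φ)]
  have h1 : Real.cos (n * (-(φ + θ) + 2 * Real.pi / n)) = Real.cos (n * θ + n * φ) := by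
    rw [← Real.cos_neg, ← Real.cos_add_two_pi]
    congr 1
    field_simp
    ring
  rw [h1, show (n : ℝ) * (θ - φ) = n * θ - n * φ by ring, Real.cos_add, Real.cos_sub]
  congr 3
  ring


/-! ### Dirichlet's integral over the simplex. -/

section

open MeasureTheory
open scoped ENNReal

/-- The density `x ^ (a - 1)` on the half line `x ≥ 0`. -/
def powDensity (a x : ℝ) : ℝ≥0∞ := if 0 ≤ x then ENNReal.ofReal (x ^ (a - 1)) else 0

lemma measurable_powDensity (a : ℝ) : Measurable (powDensity a) :=
  Measurable.ite measurableSet_Ici (by fun_prop) measurable_const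

lemma powDensity_of_neg {a x : ℝ} (hx : x < 0) : powDensity a x = 0 := by
  rw [powDensity, if_neg (not_le.2 hx)]

lemma powDensity_of_nonneg {a x : ℝ} (hx : 0 ≤ x) :
    powDensity a x = ENNReal.ofReal (x ^ (a - 1)) := by
  rw [powDensity, if_pos hx]

lemma lintegral_powDensity_one {a c : ℝ} (ha : 0 < a) (hc : 0 < c) :
    ∫⁻ v, powDensity a v * powDensity c (1 - v)
      = ENNReal.ofReal (Real.Gamma a * Real.Gamma c / Real.Gamma (a + c)) := by
  have hB := ProbabilityTheory.beta_pos ha hc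
  have h1 := ProbabilityTheory.lintegral_betaPDF_eq_one ha hc
  -- The two densities may differ at the endpoints `0` and `1`, a null set.
  have hae : ∀ᵐ v : ℝ, powDensity a v * powDensity c (1 - v)
      = ENNReal.ofReal (ProbabilityTheory.beta a c) * ProbabilityTheory.betaPDF a c v := by
    have h0 : ∀ᵐ v : ℝ, v ≠ 0 := by simp [ae_iff, measure_singleton]
    have h1 : ∀ᵐ v : ℝ, v ≠ 1 := by simp [ae_iff, measure_singleton]
    filter_upwards [h0, h1] with v hv0 hv1
    rcases lt_or_gt_of_ne hv0 with hv | hv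
    · rw [powDensity_of_neg hv, ProbabilityTheory.betaPDF_eq_zero_of_nonpos hv.le]; simp
    rcases lt_or_gt_of_ne hv1 with hv' | hv'
    · rw [ProbabilityTheory.betaPDF_of_pos_lt_one hv hv', powDensity_of_nonneg hv.le,
        powDensity_of_nonneg (sub_pos.2 hv').le, ← ENNReal.ofReal_mul (by positivity),
        ← ENNReal.ofReal_mul hB.le]
      congr 1
      field_simp
    · rw [powDensity_of_neg (a := c) (sub_neg.2 hv'),
        ProbabilityTheory.betaPDF_eq_zero_of_one_le hv'.le]
      simp
  rw [lintegral_congr_ae hae, lintegral_const_mul' _ _ ENNReal.ofReal_ne_top, h1, mul_one]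
  rfl

lemma powDensity_mul {a T : ℝ} (hT : 0 < T) (x : ℝ) :
    powDensity a (T * x) = ENNReal.ofReal (T ^ (a - 1)) * powDensity a x := by
  rcases lt_or_ge x 0 with hx | hx
  · rw [powDensity_of_neg hx, powDensity_of_neg (mul_neg_of_pos_of_neg hT hx), mul_zero]
  · rw [powDensity_of_nonneg hx, powDensity_of_nonneg (mul_nonneg hT.le hx),
      ← ENNReal.ofReal_mul (by positivity), Real.mul_rpow hT.le hx]

/-- The beta integral as a convolution of power densities. -/
lemma lintegral_powDensity {a c : ℝ} (ha : 0 < a) (hc : 0 < c) {T : ℝ} (hT : T ≠ 0) :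
    ∫⁻ v, powDensity a v * powDensity c (T - v)
      = ENNReal.ofReal (Real.Gamma a * Real.Gamma c / Real.Gamma (a + c))
        * powDensity (a + c) T := by
  rcases lt_or_gt_of_ne hT with hT | hT
  · rw [powDensity_of_neg hT, mul_zero]
    refine (lintegral_congr fun v => ?_).trans lintegral_zero
    rcases lt_or_ge v 0 with hv | hv
    · rw [powDensity_of_neg hv, zero_mul]
    · rw [powDensity_of_neg (a := c) (by linarith : T - v < 0), mul_zero]
  · have hmeas : Measurable fun v => powDensity a v * powDensity c (T - v) :=
      (measurable_powDensity a).mul ((measurable_powDensity c).comp (measurable_const.sub measurable_id))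
    rw [← Real.smul_map_volume_mul_left hT.ne', lintegral_smul_measure,
      lintegral_map hmeas (measurable_const_mul T), abs_of_pos hT]
    have : ∀ v, powDensity a (T * v) * powDensity c (T - T * v)
        = ENNReal.ofReal (T ^ (a - 1) * T ^ (c - 1)) * (powDensity a v * powDensity c (1 - v)) := by
      intro v
      rw [show T - T * v = T * (1 - v) by ring, powDensity_mul hT, powDensity_mul hT,
        ENNReal.ofReal_mul (by positivity)]
      ring
    simp only [this]
    rw [lintegral_const_mul' _ _ ENNReal.ofReal_ne_top, lintegral_powDensity_one ha hc,
      powDensity_of_nonneg hT.le, smul_eq_mul, ← mul_assoc, ← ENNReal.ofReal_mul hT.le, mul_comm]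
    congr 2
    rw [show a + c - 1 = 1 + ((a - 1) + (c - 1)) by ring, Real.rpow_add hT, Real.rpow_add hT,
      Real.rpow_one]

/-- The Dirichlet integral as an iterated convolution. -/
lemma lintegral_dirichlet (m : ℕ) (a : Fin m → ℝ) (ha : ∀ i, 0 < a i) {c : ℝ} (hc : 0 < c)
    {T : ℝ} (hT : T ≠ 0) :
    ∫⁻ u : Fin m → ℝ, (∏ i, powDensity (a i) (u i)) * powDensity c (T - ∑ i, u i)
      = ENNReal.ofReal ((∏ i, Real.Gamma (a i)) * Real.Gamma c / Real.Gamma (∑ i, a i + c))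
        * powDensity (∑ i, a i + c) T := by
  induction m generalizing T with
  | zero =>
    have : (volume : Measure (Fin 0 → ℝ)) = Measure.dirac default := by
      rw [volume_pi, Measure.pi_of_empty _ default]
    rw [this, lintegral_dirac]
    simp [div_self (Real.Gamma_pos_of_pos hc).ne']
  | succ m ih =>
    set e := MeasurableEquiv.piFinSuccAbove (fun _ : Fin (m + 1) => ℝ) 0
    have he := (volume_preserving_piFinSuccAbove (fun _ : Fin (m + 1) => ℝ) 0).symm
    have hmeas : ∀ (m : ℕ) (a : Fin m → ℝ) (T : ℝ), Measurable fun u : Fin m → ℝ =>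
        (∏ i, powDensity (a i) (u i)) * powDensity c (T - ∑ i, u i) := by
      intro m a T
      refine Measurable.mul (Finset.measurable_prod _ fun i _ =>
        (measurable_powDensity (a i)).comp (measurable_pi_apply i)) ?_
      exact (measurable_powDensity c).comp (measurable_const.sub
        (Finset.measurable_sum _ fun i _ => measurable_pi_apply i))
    rw [← he.lintegral_comp (hmeas _ a T), Measure.volume_eq_prod,
      lintegral_prod (fun z : ℝ × (Fin m → ℝ) => (∏ i, powDensity (a i) (e.symm z i))
        * powDensity c (T - ∑ i, e.symm z i))
        ((hmeas _ a T).comp e.symm.measurable).aemeasurable]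
    set A := ∑ i : Fin m, a i.succ + c with hA
    have hA0 : 0 < A := add_pos_of_nonneg_of_pos (Finset.sum_nonneg fun i _ => (ha _).le) hc
    set K := ENNReal.ofReal ((∏ i : Fin m, Real.Gamma (a i.succ)) * Real.Gamma c / Real.Gamma A)
      with hK
    -- The induction hypothesis needs `T - v ≠ 0`: at `0` the convolution formula can fail because
    -- `0 ^ 0 = 1`.
    have hT' : ∀ᵐ v : ℝ, v ≠ T := by simp [ae_iff, measure_singleton]
    have hinner : ∀ᵐ v : ℝ, (∫⁻ w : Fin m → ℝ,
        (∏ i, powDensity (a i) (e.symm (v, w) i)) * powDensity c (T - ∑ i, e.symm (v, w) i))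
        = K * (powDensity (a 0) v * powDensity A (T - v)) := by
      filter_upwards [hT'] with v hv
      have h1 : ∀ w : Fin m → ℝ, (∏ i, powDensity (a i) (e.symm (v, w) i))
          * powDensity c (T - ∑ i, e.symm (v, w) i)
          = powDensity (a 0) v * ((∏ i : Fin m, powDensity (a i.succ) (w i))
            * powDensity c ((T - v) - ∑ i, w i)) := by
        intro w
        have h0 : e.symm (v, w) 0 = v := by simp [e, MeasurableEquiv.piFinSuccAbove]
        have hs : ∀ i : Fin m, e.symm (v, w) i.succ = w i := by
          intro i; simp [e, MeasurableEquiv.piFinSuccAbove]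
        rw [Fin.prod_univ_succ, Fin.sum_univ_succ, h0]
        simp only [hs]
        rw [mul_assoc, sub_sub]
      simp only [h1]
      rw [lintegral_const_mul _ (hmeas m (fun i => a i.succ) (T - v)),
        ih (fun i => a i.succ) (fun i => ha _) (sub_ne_zero.2 (Ne.symm hv)), ← hA, ← hK]
      ring
    have hinner' := lintegral_congr_ae hinner
    refine hinner'.trans ?_
    rw [lintegral_const_mul' _ _ ENNReal.ofReal_ne_top, lintegral_powDensity (ha 0) hA0 hT,
      ← mul_assoc, ← ENNReal.ofReal_mul (by
        refine div_nonneg (mul_nonneg (Finset.prod_nonneg fun i _ => ?_) ?_) ?_ <;>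
        exact (Real.Gamma_pos_of_pos (by first | exact ha _ | assumption)).le),
      Fin.prod_univ_succ, Fin.sum_univ_succ, add_assoc, ← hA]
    congr 2
    have := (Real.Gamma_pos_of_pos hA0).ne'
    field_simp

lemma measurableSet_simplex (m : ℕ) : MeasurableSet (simplex m) := by
  have : simplex m = (⋂ i, {u | 0 ≤ u i}) ∩ {u | 0 ≤ 1 - ∑ i, u i} := by
    ext u; simp [simplex]
  rw [this]
  refine MeasurableSet.inter (MeasurableSet.iInter fun i => ?_) ?_
  · exact measurableSet_le measurable_const (measurable_pi_apply i)
  · exact measurableSet_le measurable_const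
      (measurable_const.sub (Finset.measurable_sum _ fun i _ => measurable_pi_apply i))

/-- Dirichlet's integral over the simplex. -/
lemma integral_dirichlet (m : ℕ) (a : Fin m → ℝ) (ha : ∀ i, 0 < a i) {c : ℝ} (hc : 0 < c) :
    IntegrableOn (fun u : Fin m → ℝ => (1 - ∑ i, u i) ^ (c - 1) * ∏ i, u i ^ (a i - 1))
      (simplex m) ∧
    ∫ u in simplex m, (1 - ∑ i, u i) ^ (c - 1) * ∏ i, u i ^ (a i - 1)
      = (∏ i, Real.Gamma (a i)) * Real.Gamma c / Real.Gamma (∑ i, a i + c) := by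
  have hmeas : Measurable fun u : Fin m → ℝ =>
      (1 - ∑ i, u i) ^ (c - 1) * ∏ i, u i ^ (a i - 1) := by fun_prop
  have hnn : ∀ u ∈ simplex m, 0 ≤ (1 - ∑ i, u i) ^ (c - 1) * ∏ i, u i ^ (a i - 1) :=
    fun u hu => mul_nonneg (Real.rpow_nonneg hu.2 _)
      (Finset.prod_nonneg fun i _ => Real.rpow_nonneg (hu.1 i) _)
  have hA0 : 0 < ∑ i, a i + c :=
    add_pos_of_nonneg_of_pos (Finset.sum_nonneg fun i _ => (ha _).le) hc
  have hval : 0 ≤ (∏ i, Real.Gamma (a i)) * Real.Gamma c / Real.Gamma (∑ i, a i + c) :=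
    div_nonneg (mul_nonneg (Finset.prod_nonneg fun i _ => (Real.Gamma_pos_of_pos (ha i)).le)
      (Real.Gamma_pos_of_pos hc).le) (Real.Gamma_pos_of_pos hA0).le
  have key : ∫⁻ u in simplex m,
      ENNReal.ofReal ((1 - ∑ i, u i) ^ (c - 1) * ∏ i, u i ^ (a i - 1))
      = ENNReal.ofReal ((∏ i, Real.Gamma (a i)) * Real.Gamma c / Real.Gamma (∑ i, a i + c)) := by
    have h := lintegral_dirichlet m a ha hc one_ne_zero
    rw [powDensity_of_nonneg zero_le_one, Real.one_rpow, ENNReal.ofReal_one, mul_one] at h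
    rw [← h, ← lintegral_indicator (measurableSet_simplex m)]
    refine lintegral_congr fun u => ?_
    by_cases hu : u ∈ simplex m
    · rw [Set.indicator_of_mem hu, ENNReal.ofReal_mul (Real.rpow_nonneg hu.2 _),
        ENNReal.ofReal_prod_of_nonneg fun i _ => Real.rpow_nonneg (hu.1 i) _, mul_comm,
        powDensity_of_nonneg hu.2]
      congr 1
      exact Finset.prod_congr rfl fun i _ => (powDensity_of_nonneg (hu.1 i)).symm
    · rw [Set.indicator_of_notMem hu]
      simp only [simplex, Set.mem_ofPred_eq, not_and_or, not_forall, not_le] at hu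
      rcases hu with ⟨i, hi⟩ | hi
      · rw [Finset.prod_eq_zero (Finset.mem_univ i) (powDensity_of_neg hi), zero_mul]
      · rw [powDensity_of_neg hi, mul_zero]
  have hae : 0 ≤ᵐ[volume.restrict (simplex m)] fun u : Fin m → ℝ =>
      (1 - ∑ i, u i) ^ (c - 1) * ∏ i, u i ^ (a i - 1) :=
    (ae_restrict_iff' (measurableSet_simplex m)).2 (Filter.Eventually.of_forall hnn)
  refine ⟨⟨hmeas.aestronglyMeasurable, ?_⟩, ?_⟩
  · rw [hasFiniteIntegral_iff_ofReal hae, key]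
    exact ENNReal.ofReal_lt_top
  · rw [integral_eq_lintegral_of_nonneg_ae hae hmeas.aestronglyMeasurable, key,
      ENNReal.toReal_ofReal hval]

/-- All barycentric coordinates `(u₀, u₁, …, u_m)`. -/
def bary {m : ℕ} (u : Fin m → ℝ) : Fin (m + 1) → ℝ := Fin.cons (1 - ∑ i, u i) u

lemma bary_nonneg {m : ℕ} {u : Fin m → ℝ} (hu : u ∈ simplex m) (s : Fin (m + 1)) :
    0 ≤ bary u s := by
  induction s using Fin.cases with
  | zero => simpa [bary] using hu.2
  | succ i => simpa [bary] using hu.1 i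

lemma sum_bary {m : ℕ} (u : Fin m → ℝ) : ∑ s, bary u s = 1 := by
  simp [bary, Fin.sum_univ_succ]

lemma bary_le_one {m : ℕ} {u : Fin m → ℝ} (hu : u ∈ simplex m) (s : Fin (m + 1)) :
    bary u s ≤ 1 := by
  rw [← sum_bary u]
  exact Finset.single_le_sum (fun s _ => bary_nonneg hu s) (Finset.mem_univ s)

/-- Dirichlet's integral in barycentric coordinates. -/
lemma integral_bary (m : ℕ) (a : Fin (m + 1) → ℝ) (ha : ∀ i, 0 < a i) :
    IntegrableOn (fun u : Fin m → ℝ => ∏ s, bary u s ^ (a s - 1)) (simplex m) ∧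
    ∫ u in simplex m, ∏ s, bary u s ^ (a s - 1)
      = (∏ s, Real.Gamma (a s)) / Real.Gamma (∑ s, a s) := by
  have h := integral_dirichlet m (fun i => a i.succ) (fun i => ha _) (ha 0)
  have e : ∀ u : Fin m → ℝ, ∏ s, bary u s ^ (a s - 1)
      = (1 - ∑ i, u i) ^ (a 0 - 1) * ∏ i, u i ^ (a i.succ - 1) := by
    intro u
    simp [bary, Fin.prod_univ_succ]
  simp only [e]
  rw [Fin.prod_univ_succ, Fin.sum_univ_succ, add_comm (a 0), mul_comm (Real.Gamma _)]
  exact h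

end


/-! ### Moments of a linear form and hypergeometric coefficients. -/

section

open MeasureTheory

lemma Gamma_add_nat {a : ℝ} (ha : 0 < a) (j : ℕ) :
    Real.Gamma (a + j) = (ascPochhammer ℝ j).eval a * Real.Gamma a := by
  induction j with
  | zero => simp
  | succ j ih =>
    rw [ascPochhammer_succ_eval, Nat.cast_succ, ← add_assoc, Real.Gamma_add_one (by positivity), ih]
    ring

lemma rpow_sub_one_mul_pow {κ x : ℝ} (hκ : 0 < κ) (hx : 0 ≤ x) (j : ℕ) :
    x ^ (κ - 1) * x ^ j = x ^ (κ + j - 1) := by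
  rcases Nat.eq_zero_or_pos j with rfl | hj
  · simp
  rcases hx.eq_or_lt with rfl | hx
  · have : (0 : ℝ) < κ + j - 1 := by
      have : (1 : ℝ) ≤ j := by exact_mod_cast hj
      linarith
    rw [zero_pow hj.ne', mul_zero, Real.zero_rpow this.ne']
  · rw [← Real.rpow_natCast, ← Real.rpow_add hx]
    congr 1
    ring

lemma coeff_prod_eq_sum_piAntidiag {n : ℕ} (f : Fin n → PowerSeries ℝ) (p : ℕ) :
    PowerSeries.coeff p (∏ s, f s)
      = ∑ β ∈ Finset.piAntidiag Finset.univ p, ∏ s, PowerSeries.coeff (β s) (f s) := by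
  rw [PowerSeries.coeff_prod]
  refine Finset.sum_bij' (fun l _ => (l : Fin n → ℕ)) (fun β _ => Finsupp.equivFunOnFinite.symm β)
    ?_ ?_ ?_ ?_ ?_
  · intro l hl
    rw [Finset.mem_finsuppAntidiag] at hl
    rw [Finset.mem_piAntidiag]
    exact ⟨hl.1, fun _ _ => Finset.mem_univ _⟩
  · intro β hβ
    rw [Finset.mem_piAntidiag] at hβ
    rw [Finset.mem_finsuppAntidiag]
    exact ⟨by simpa using hβ.1, Finset.subset_univ _⟩
  · intro l _
    ext; simp
  · intro β _
    ext; simp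
  · intro l _
    rfl

/-- The moments of a linear form under the Dirichlet density with equal parameters. -/
lemma integral_linear_pow (m : ℕ) (l : Fin (m + 1) → ℝ) {κ : ℝ} (hκ : 0 < κ) (p : ℕ) :
    IntegrableOn (fun u : Fin m → ℝ => (∑ s, bary u s * l s) ^ p * ∏ s, bary u s ^ (κ - 1))
      (simplex m) ∧
    ∫ u in simplex m, (∑ s, bary u s * l s) ^ p * ∏ s, bary u s ^ (κ - 1)
      = (p.factorial : ℝ) * Real.Gamma κ ^ (m + 1) / Real.Gamma ((m + 1 : ℕ) * κ + p)
        * PowerSeries.coeff p (binomProd κ l) := by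
  set A := Finset.piAntidiag (Finset.univ : Finset (Fin (m + 1))) p with hA
  have hd : ∀ β : Fin (m + 1) → ℕ, _ := fun β =>
    integral_bary m (fun s => κ + β s) (fun s => by positivity)
  have hexp : ∀ u ∈ simplex m, (∑ s, bary u s * l s) ^ p * ∏ s, bary u s ^ (κ - 1)
      = ∑ β ∈ A, ((Nat.multinomial Finset.univ β : ℝ) * ∏ s, l s ^ β s)
        * ∏ s, bary u s ^ (κ + β s - 1) := by
    intro u hu
    rw [Finset.sum_pow_eq_sum_piAntidiag, Finset.sum_mul]
    refine Finset.sum_congr rfl fun β _ => ?_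
    simp only [← rpow_sub_one_mul_pow hκ (bary_nonneg hu _), mul_pow, Finset.prod_mul_distrib]
    ring
  have hint : ∀ β ∈ A, IntegrableOn (fun u : Fin m → ℝ =>
      ((Nat.multinomial Finset.univ β : ℝ) * ∏ s, l s ^ β s)
        * ∏ s, bary u s ^ (κ + β s - 1)) (simplex m) := fun β _ => (hd β).1.const_mul _
  refine ⟨(integrableOn_congr_fun hexp (measurableSet_simplex m)).2
    (integrable_finsetSum _ hint), ?_⟩
  rw [setIntegral_congr_fun (measurableSet_simplex m) hexp, integral_finsetSum _ hint, binomProd,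
    coeff_prod_eq_sum_piAntidiag, Finset.mul_sum]
  refine Finset.sum_congr rfl fun β hβ => ?_
  have hβs : ∑ s, β s = p := (Finset.mem_piAntidiag.1 hβ).1
  have hsum : ∑ s, (κ + β s) = (m + 1 : ℕ) * κ + p := by
    rw [Finset.sum_add_distrib, ← hβs]; simp
  rw [integral_const_mul, (hd β).2, hsum]
  have hmul : (∏ s, ((β s).factorial : ℝ)) * (Nat.multinomial Finset.univ β : ℝ)
      = (p.factorial : ℝ) := by
    have := Nat.multinomial_spec Finset.univ β
    rw [hβs] at this
    exact_mod_cast this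
  have hfac : (∏ s, ((β s).factorial : ℝ)) ≠ 0 :=
    Finset.prod_ne_zero_iff.2 fun s _ => by positivity
  simp only [binom, PowerSeries.coeff_mk, Gamma_add_nat hκ, Finset.prod_mul_distrib,
    Finset.prod_div_distrib]
  rw [← hmul]
  simp only [Finset.prod_const, Finset.card_univ, Fintype.card_fin]
  field_simp

/-- Coefficients of `₀F_m(2k, k, …, k; ·)` evaluated along `-δ`. -/
def expCoeff (m : ℕ) (k δ : ℝ) (j : ℕ) : ℝ :=
  1 / ((ascPochhammer ℝ j).eval (2 * k) * (ascPochhammer ℝ j).eval k ^ (m - 1))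
    * ((-δ) ^ j / (j.factorial : ℝ))

lemma prod_params {m : ℕ} (hm : 1 ≤ m) (k : ℝ) (f : ℝ → ℝ) :
    ∏ i : Fin m, f (params m k i) = f (2 * k) * f k ^ (m - 1) := by
  obtain ⟨p, rfl⟩ := Nat.exists_eq_add_of_le' hm
  rw [Fin.prod_univ_succ]
  simp [params]

lemma min_one_le_ascPochhammer {a : ℝ} (ha : 0 < a) (j : ℕ) :
    min 1 a ≤ (ascPochhammer ℝ j).eval a := by
  rcases Nat.eq_zero_or_pos j with rfl | hj
  · simp
  refine (min_le_right _ _).trans ?_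
  induction j, hj using Nat.le_induction with
  | base => simp
  | succ j hj ih =>
    rw [ascPochhammer_succ_eval]
    have : (1 : ℝ) ≤ j := by exact_mod_cast hj
    nlinarith

lemma abs_expCoeff_le {m : ℕ} {k : ℝ} (hk : 0 < k) (δ : ℝ) (j : ℕ) :
    |expCoeff m k δ j| ≤ 1 / (min 1 (2 * k) * min 1 k ^ (m - 1))
      * (|δ| ^ j / (j.factorial : ℝ)) := by
  have h1 : 0 < min 1 (2 * k) := lt_min one_pos (by linarith)
  have h2 : 0 < min 1 k := lt_min one_pos hk
  have h3 := min_one_le_ascPochhammer (show 0 < 2 * k by linarith) j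
  have h4 := min_one_le_ascPochhammer hk j
  have h5 := ascPochhammer_eval_pos (show 0 < 2 * k by linarith) j
  have h6 := ascPochhammer_eval_pos hk j
  rw [expCoeff, abs_mul, abs_div, abs_div, abs_pow, abs_neg, abs_one, abs_mul, abs_of_pos h5,
    abs_of_pos (pow_pos h6 _), Nat.abs_cast]
  gcongr

lemma hasSum_hyp0F {m : ℕ} (hm : 1 ≤ m) {k : ℝ} (hk : 0 < k) (z : ℝ) :
    HasSum (fun j => expCoeff m k (-z) j) (hyp0F (params m k) z) := by
  have hs : Summable fun j => expCoeff m k (-z) j :=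
    Summable.of_norm_bounded ((Real.summable_pow_div_factorial |-z|).mul_left _)
      fun j => abs_expCoeff_le hk (-z) j
  have : hyp0F (params m k) z = ∑' j, expCoeff m k (-z) j := by
    unfold hyp0F expCoeff
    refine tsum_congr fun j => ?_
    rw [prod_params hm k (fun a => (ascPochhammer ℝ j).eval a), neg_neg]
  rw [this]
  exact hs.hasSum

lemma expCoeff_mul (m : ℕ) (k δ c : ℝ) (j : ℕ) :
    expCoeff m k (δ * c) j = expCoeff m k δ j * c ^ j := by
  unfold expCoeff
  rw [← neg_mul, mul_pow]
  ring

/-- The nodes seen from the simplex: the exponent is a barycentric combination. -/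
lemma integrand_eq {m : ℕ} (k ρ φ r θ : ℝ) (u : Fin m → ℝ) :
    integrand (m + 1) k ρ φ r θ u
      = Real.exp (∑ s, bary u s * nodes (m + 1) ρ φ r θ s)
        * hyp0F (params m k) (-(4 * (ρ * r / 2) ^ (m + 1) * Real.sin ((m + 1 : ℕ) * θ)
            * Real.sin ((m + 1 : ℕ) * φ) * ∏ s, bary u s))
        * ∏ s, bary u s ^ (k - 1) := by
  have h : integrand (m + 1) k ρ φ r θ u
      = Real.exp (ρ * r * ((1 - ∑ i, u i) * Real.cos (θ - φ)
          + ∑ i, u i * b (m + 1) (θ - φ) ((i : ℕ) + 1)))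
        * hyp0F (params m k) (-4 * (ρ * r / 2) ^ (m + 1) * ((1 - ∑ i, u i) * ∏ i, u i)
          * Real.sin ((m + 1 : ℕ) * θ) * Real.sin ((m + 1 : ℕ) * φ))
        * ((1 - ∑ i, u i) ^ (k - 1) * ∏ i, u i ^ (k - 1)) := rfl
  rw [h]
  simp only [Fin.prod_univ_succ (n := m), Fin.sum_univ_succ (n := m), bary, Fin.cons_zero,
    Fin.cons_succ, nodes]
  congr 2
  · congr 1
    rw [mul_add, Finset.mul_sum]
    congr 1
    · simp [b]; ring
    · refine Finset.sum_congr rfl fun i _ => ?_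
      simp only [Fin.val_succ]
      ring
  · congr 1
    ring

end


section

open MeasureTheory

lemma measurable_hyp0F {m : ℕ} (hm : 1 ≤ m) {k : ℝ} (hk : 0 < k) :
    Measurable (hyp0F (params m k)) := by
  refine measurable_of_tendsto_metrizable
    (f := fun (N : ℕ) z => ∑ j ∈ Finset.range N, expCoeff m k (-z) j) (fun N => ?_) ?_
  · unfold expCoeff
    fun_prop
  · exact tendsto_pi_nhds.2 fun z => (hasSum_hyp0F hm hk z).tendsto_sum_nat

lemma measurable_integrand {m : ℕ} (hm : 1 ≤ m) {k : ℝ} (hk : 0 < k) (ρ φ r θ : ℝ) :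
    Measurable fun u : Fin m → ℝ => integrand (m + 1) k ρ φ r θ u := by
  have hb : ∀ s, Measurable fun u : Fin m → ℝ => bary u s := by
    intro s
    induction s using Fin.cases with
    | zero => simp only [bary, Fin.cons_zero]; fun_prop
    | succ i => simp only [bary, Fin.cons_succ]; fun_prop
  simp only [integrand_eq]
  refine Measurable.mul (Measurable.mul ?_ ((measurable_hyp0F hm hk).comp ?_)) ?_ <;> fun_prop

/-- The general term of the double expansion of the integrand. -/
def expansionTerm {m : ℕ} (k δ : ℝ) (l : Fin (m + 1) → ℝ) (q : ℕ × ℕ) (u : Fin m → ℝ) : ℝ :=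
  expCoeff m k δ q.1 / (q.2.factorial : ℝ)
    * ((∑ s, bary u s * l s) ^ q.2 * ∏ s, bary u s ^ (k + q.1 - 1))

/-- The summable bound for the coefficients of the double expansion. -/
def expansionBound {m : ℕ} (k δ : ℝ) (l : Fin (m + 1) → ℝ) (q : ℕ × ℕ) : ℝ :=
  |expCoeff m k δ q.1| * ((∑ s, |l s|) ^ q.2 / (q.2.factorial : ℝ))

lemma summable_expansionBound {m : ℕ} {k : ℝ} (hk : 0 < k) (δ : ℝ) (l : Fin (m + 1) → ℝ) :
    Summable (expansionBound k δ l) := by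
  have h1 : Summable fun j => |expCoeff m k δ j| :=
    Summable.of_nonneg_of_le (fun j => abs_nonneg _) (abs_expCoeff_le hk δ)
      ((Real.summable_pow_div_factorial |δ|).mul_left _)
  exact h1.mul_of_nonneg (Real.summable_pow_div_factorial (∑ s, |l s|)) (fun j => abs_nonneg _)
    fun p => by positivity

lemma prod_bary_rpow {m : ℕ} {k : ℝ} (hk : 0 < k) {u : Fin m → ℝ} (hu : u ∈ simplex m) (j : ℕ) :
    ∏ s, bary u s ^ (k + j - 1) = (∏ s, bary u s) ^ j * ∏ s, bary u s ^ (k - 1) := by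
  simp only [← rpow_sub_one_mul_pow hk (bary_nonneg hu _), Finset.prod_mul_distrib,
    Finset.prod_pow]
  ring

lemma prod_bary_mem {m : ℕ} {u : Fin m → ℝ} (hu : u ∈ simplex m) :
    0 ≤ ∏ s, bary u s ∧ ∏ s, bary u s ≤ 1 :=
  ⟨Finset.prod_nonneg fun s _ => bary_nonneg hu s,
    Finset.prod_le_one (fun s _ => bary_nonneg hu s) fun s _ => bary_le_one hu s⟩

lemma abs_linear_le {m : ℕ} (l : Fin (m + 1) → ℝ) {u : Fin m → ℝ} (hu : u ∈ simplex m) :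
    |∑ s, bary u s * l s| ≤ ∑ s, |l s| := by
  refine (Finset.abs_sum_le_sum_abs _ _).trans (Finset.sum_le_sum fun s _ => ?_)
  rw [abs_mul, abs_of_nonneg (bary_nonneg hu s)]
  exact mul_le_of_le_one_left (abs_nonneg _) (bary_le_one hu s)

lemma prod_rpow_nonneg {m : ℕ} (k : ℝ) {u : Fin m → ℝ} (hu : u ∈ simplex m) :
    0 ≤ ∏ s, bary u s ^ (k - 1) :=
  Finset.prod_nonneg fun s _ => Real.rpow_nonneg (bary_nonneg hu s) _

lemma norm_expansionTerm_le {m : ℕ} {k : ℝ} (hk : 0 < k) (δ : ℝ) (l : Fin (m + 1) → ℝ)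
    (q : ℕ × ℕ) {u : Fin m → ℝ} (hu : u ∈ simplex m) :
    ‖expansionTerm k δ l q u‖ ≤ expansionBound k δ l q * ∏ s, bary u s ^ (k - 1) := by
  have hW := prod_rpow_nonneg k hu
  obtain ⟨hp0, hp1⟩ := prod_bary_mem hu
  rw [expansionTerm, expansionBound, prod_bary_rpow hk hu, Real.norm_eq_abs, abs_mul, abs_div,
    abs_mul, abs_mul, abs_pow, abs_pow, abs_of_nonneg hW, abs_of_nonneg hp0, Nat.abs_cast]
  have h1 : |∑ s, bary u s * l s| ^ q.2 ≤ (∑ s, |l s|) ^ q.2 :=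
    pow_le_pow_left₀ (abs_nonneg _) (abs_linear_le l hu) _
  have h2 : (∏ s, bary u s) ^ q.1 ≤ 1 := pow_le_one₀ hp0 hp1
  have h3 : 0 ≤ (∏ s, bary u s) ^ q.1 := pow_nonneg hp0 _
  calc |expCoeff m k δ q.1| / (q.2.factorial : ℝ) * (|∑ s, bary u s * l s| ^ q.2
        * ((∏ s, bary u s) ^ q.1 * ∏ s, bary u s ^ (k - 1)))
      ≤ |expCoeff m k δ q.1| / (q.2.factorial : ℝ) * ((∑ s, |l s|) ^ q.2
        * (1 * ∏ s, bary u s ^ (k - 1))) := by gcongr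
    _ = _ := by ring

lemma hasSum_expansionTerm {m : ℕ} (hm : 1 ≤ m) {k : ℝ} (hk : 0 < k) (ρ φ r θ : ℝ)
    {u : Fin m → ℝ} (hu : u ∈ simplex m) :
    HasSum (fun q => expansionTerm k (4 * (ρ * r / 2) ^ (m + 1) * Real.sin ((m + 1 : ℕ) * θ)
        * Real.sin ((m + 1 : ℕ) * φ)) (nodes (m + 1) ρ φ r θ) q u)
      (integrand (m + 1) k ρ φ r θ u) := by
  set δ := 4 * (ρ * r / 2) ^ (m + 1) * Real.sin ((m + 1 : ℕ) * θ)
        * Real.sin ((m + 1 : ℕ) * φ) with hδ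
  set l := nodes (m + 1) ρ φ r θ
  have h1 : HasSum (fun p : ℕ => (∑ s, bary u s * l s) ^ p / (p.factorial : ℝ))
      (Real.exp (∑ s, bary u s * l s)) := by
    rw [Real.exp_eq_exp_ℝ]
    exact NormedSpace.expSeries_div_hasSum_exp _
  have h2 := hasSum_hyp0F hm hk (-(δ * ∏ s, bary u s))
  simp only [neg_neg, expCoeff_mul] at h2
  have hsum : Summable fun q : ℕ × ℕ => expansionTerm k δ l q u :=
    Summable.of_norm_bounded ((summable_expansionBound hk δ l).mul_right _)
      fun q => norm_expansionTerm_le hk δ l q hu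
  have hterm : ∀ q : ℕ × ℕ, expansionTerm k δ l q u
      = (expCoeff m k δ q.1 * (∏ s, bary u s) ^ q.1
          * ((∑ s, bary u s * l s) ^ q.2 / (q.2.factorial : ℝ))) * ∏ s, bary u s ^ (k - 1) := by
    intro q
    rw [expansionTerm, prod_bary_rpow hk hu]
    ring
  rcases eq_or_ne (∏ s, bary u s ^ (k - 1)) 0 with h0 | h0
  · rw [integrand_eq, h0, mul_zero]
    simp only [hterm, h0, mul_zero]
    exact hasSum_zero
  · have h3 : Summable fun q : ℕ × ℕ => expCoeff m k δ q.1 * (∏ s, bary u s) ^ q.1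
        * ((∑ s, bary u s * l s) ^ q.2 / (q.2.factorial : ℝ)) := by
      simp only [hterm] at hsum
      exact (summable_mul_right_iff h0).1 hsum
    have h4 := (h2.mul h1 h3).mul_right (∏ s, bary u s ^ (k - 1))
    simp only [hterm]
    rw [integrand_eq, mul_comm (Real.exp _)]
    exact h4

lemma integral_expansionTerm {m : ℕ} {k : ℝ} (hk : 0 < k) (δ : ℝ) (l : Fin (m + 1) → ℝ)
    (q : ℕ × ℕ) :
    IntegrableOn (expansionTerm k δ l q) (simplex m) ∧
    ∫ u in simplex m, expansionTerm k δ l q u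
      = expCoeff m k δ q.1 * Real.Gamma (k + q.1) ^ (m + 1)
        / Real.Gamma ((m + 1 : ℕ) * (k + q.1) + q.2)
        * PowerSeries.coeff q.2 (binomProd (k + q.1) l) := by
  have h := integral_linear_pow m l (show 0 < k + (q.1 : ℝ) by positivity) q.2
  refine ⟨h.1.const_mul _, ?_⟩
  unfold expansionTerm
  rw [integral_const_mul, h.2]
  have : (q.2.factorial : ℝ) ≠ 0 := by positivity
  field_simp

lemma integrable_weight (m : ℕ) {k : ℝ} (hk : 0 < k) :
    IntegrableOn (fun u : Fin m → ℝ => ∏ s, bary u s ^ (k - 1)) (simplex m) :=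
  (integral_bary m (fun _ => k) fun _ => hk).1

lemma integrable_integrand {m : ℕ} (hm : 1 ≤ m) {k : ℝ} (hk : 0 < k) (ρ φ r θ : ℝ) :
    IntegrableOn (integrand (m + 1) k ρ φ r θ) (simplex m) := by
  set δ := 4 * (ρ * r / 2) ^ (m + 1) * Real.sin ((m + 1 : ℕ) * θ) * Real.sin ((m + 1 : ℕ) * φ)
  set l := nodes (m + 1) ρ φ r θ
  refine Integrable.mono' ((integrable_weight m hk).const_mul (∑' q, expansionBound k δ l q))
    (measurable_integrand hm hk ρ φ r θ).aestronglyMeasurable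
    ((ae_restrict_iff' (measurableSet_simplex m)).2 (Filter.Eventually.of_forall fun u hu => ?_))
  rw [← (hasSum_expansionTerm hm hk ρ φ r θ hu).tsum_eq, ← tsum_mul_right]
  exact tsum_of_norm_bounded ((summable_expansionBound hk δ l).mul_right _).hasSum
    fun q => norm_expansionTerm_le hk δ l q hu

lemma hasSum_integral_integrand {m : ℕ} (hm : 1 ≤ m) {k : ℝ} (hk : 0 < k) (ρ φ r θ : ℝ) :
    HasSum (fun q => ∫ u in simplex m, expansionTerm k (4 * (ρ * r / 2) ^ (m + 1)
        * Real.sin ((m + 1 : ℕ) * θ) * Real.sin ((m + 1 : ℕ) * φ)) (nodes (m + 1) ρ φ r θ) q u)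
      (∫ u in simplex m, integrand (m + 1) k ρ φ r θ u) := by
  set δ := 4 * (ρ * r / 2) ^ (m + 1) * Real.sin ((m + 1 : ℕ) * θ) * Real.sin ((m + 1 : ℕ) * φ)
  set l := nodes (m + 1) ρ φ r θ
  have hI : ∀ q, IntegrableOn (expansionTerm k δ l q) (simplex m) :=
    fun q => (integral_expansionTerm hk δ l q).1
  have h := hasSum_integral_of_summable_integral_norm (μ := volume.restrict (simplex m)) hI ?_
  · rwa [setIntegral_congr_fun (measurableSet_simplex m)
      fun u hu => (hasSum_expansionTerm hm hk ρ φ r θ hu).tsum_eq] at h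
  · refine Summable.of_nonneg_of_le (fun q => integral_nonneg fun u => norm_nonneg _) (fun q => ?_)
      ((summable_expansionBound hk δ l).mul_right
        (∫ u in simplex m, ∏ s, bary u s ^ (k - 1)))
    rw [← integral_const_mul]
    exact setIntegral_mono_on (hI q).norm ((integrable_weight m hk).const_mul _)
      (measurableSet_simplex m) fun u hu => norm_expansionTerm_le hk δ l q hu

/-- Regrouping a double series according to the total degree `n j + p`. -/
lemma hasSum_regroup {n : ℕ} (hn : n ≠ 0) {f : ℕ × ℕ → ℝ} {a : ℝ} (hf : HasSum f a) :
    HasSum (fun M => ∑ j ∈ Finset.range (M + 1), if n * j ≤ M then f (j, M - n * j) else 0) a := by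
  set g : ℕ × ℕ → ℝ := fun q => if n * q.1 ≤ q.2 then f (q.1, q.2 - n * q.1) else 0 with hg
  have hinj : Function.Injective fun q : ℕ × ℕ => (q.1, n * q.1 + q.2) := by
    rintro ⟨a, b⟩ ⟨c, d⟩ h
    simp only [Prod.mk.injEq] at h
    obtain ⟨rfl, h⟩ := h
    exact Prod.ext rfl (Nat.add_left_cancel h)
  have hcomp : (g ∘ fun q : ℕ × ℕ => (q.1, n * q.1 + q.2)) = f := by
    funext q
    simp only [hg, Function.comp_apply]
    rw [if_pos (Nat.le_add_right _ _), Nat.add_sub_cancel_left]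
  have h1 : HasSum g a := by
    refine (hinj.hasSum_iff (f := g) ?_).1 (by rwa [hcomp])
    rintro ⟨j, M⟩ hx
    simp only [hg]
    rw [if_neg]
    intro hle
    exact hx ⟨(j, M - n * j), Prod.ext rfl (Nat.add_sub_cancel' hle)⟩
  have h2 : HasSum (g ∘ (Equiv.prodComm ℕ ℕ)) a := (Equiv.prodComm ℕ ℕ).hasSum_iff.2 h1
  refine HasSum.prod_fiberwise (f := g ∘ (Equiv.prodComm ℕ ℕ)) h2 fun M => ?_
  have h3 : HasSum (fun j => g (j, M)) (∑ j ∈ Finset.range (M + 1), g (j, M)) := by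
    refine hasSum_sum_of_ne_finset_zero fun j hj => ?_
    rw [Finset.mem_range, not_lt] at hj
    simp only [hg]
    rw [if_neg]
    intro hle
    have := Nat.le_mul_of_pos_left j (Nat.pos_of_ne_zero hn)
    omega
  exact h3

lemma hypCoeff_eq (m : ℕ) (hm : 1 ≤ m) {k : ℝ} (hk : 0 < k) (δ : ℝ) (j : ℕ) :
    hypCoeff k δ j = expCoeff m k δ j * (ascPochhammer ℝ j).eval k ^ (m + 1) := by
  obtain ⟨p, rfl⟩ := Nat.exists_eq_add_of_le' hm
  have h1 := (ascPochhammer_eval_pos (show 0 < 2 * k by linarith) j).ne'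
  have h2 := (ascPochhammer_eval_pos hk j).ne'
  unfold hypCoeff expCoeff
  rw [Nat.add_sub_cancel]
  field_simp
  ring

lemma const_mul_integral_expansionTerm {m : ℕ} (hm : 1 ≤ m) {k : ℝ} (hk : 0 < k) (δ : ℝ)
    (l : Fin (m + 1) → ℝ) (j p : ℕ) :
    Real.Gamma ((m + 1 : ℕ) * k) / Real.Gamma k ^ (m + 1)
      * ∫ u in simplex m, expansionTerm k δ l (j, p) u
      = hypCoeff k δ j * PowerSeries.coeff p (binomProd (k + j) l)
        / (ascPochhammer ℝ ((m + 1) * j + p)).eval ((m + 1 : ℕ) * k) := by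
  have hnk : 0 < ((m + 1 : ℕ) : ℝ) * k := by positivity
  rw [(integral_expansionTerm hk δ l (j, p)).2, hypCoeff_eq m hm hk, Gamma_add_nat hk,
    show ((m + 1 : ℕ) : ℝ) * (k + (j, p).1) + (j, p).2
      = ((m + 1 : ℕ) : ℝ) * k + ((m + 1) * j + p : ℕ) by push_cast; ring, Gamma_add_nat hnk]
  have h1 := (Real.Gamma_pos_of_pos hk).ne'
  have h2 := (Real.Gamma_pos_of_pos hnk).ne'
  have h3 := (ascPochhammer_eval_pos hnk ((m + 1) * j + p)).ne'
  rw [mul_pow]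
  generalize (ascPochhammer ℝ ((m + 1) * j + p)).eval (((m + 1 : ℕ) : ℝ) * k) = P at h3 ⊢
  generalize Real.Gamma (((m + 1 : ℕ) : ℝ) * k) = G at h2 ⊢
  field_simp

/-- The integral representation of the generalized Bessel function with explicit constant. -/
lemma generalizedBessel_eq {m : ℕ} (hm : 1 ≤ m) {k : ℝ} (hk : 0 < k) (ρ φ r θ : ℝ) :
    generalizedBessel (m + 1) k ((ρ : ℂ) * Complex.exp ((φ : ℂ) * Complex.I))
        ((r : ℂ) * Complex.exp ((θ : ℂ) * Complex.I))
      = Real.Gamma ((m + 1 : ℕ) * k) / Real.Gamma k ^ (m + 1)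
        * ∫ u in simplex m, integrand (m + 1) k ρ φ r θ u := by
  set δ := 4 * (ρ * r / 2) ^ (m + 1) * Real.sin ((m + 1 : ℕ) * θ) * Real.sin ((m + 1 : ℕ) * φ)
    with hδ
  set l := nodes (m + 1) ρ φ r θ with hl
  set x := (ρ : ℂ) * Complex.exp ((φ : ℂ) * Complex.I)
  set y := (r : ℂ) * Complex.exp ((θ : ℂ) * Complex.I)
  have hn : m + 1 ≠ 0 := Nat.succ_ne_zero m
  obtain ⟨M, hM⟩ := exists_isComponents (m + 1) hk y
  have h1 := hM.hasSum_generalizedBessel hn hk x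
  simp only [hM.orbit_sum_eq hn hk x l (nodePoly_rotate hn ρ φ r θ)
    (nodePoly_reflect hn ρ φ r θ)] at h1
  have h2 := hasSum_regroup hn ((hasSum_integral_integrand hm hk ρ φ r θ).mul_left
    (Real.Gamma ((m + 1 : ℕ) * k) / Real.Gamma k ^ (m + 1)))
  refine h1.unique ?_
  convert! h2 using 2 with M
  rw [Finset.sum_div]
  refine Finset.sum_congr rfl fun j _ => ?_
  rw [PowerSeries.coeff_X_pow_mul']
  split_ifs with hle
  · rw [const_mul_integral_expansionTerm hm hk, Nat.add_sub_cancel' hle]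
  · rw [mul_zero, zero_div]

end

end Dihedral

end


theorem corollary2 (n : ℕ) (hn : 3 ≤ n) (k : ℝ) (hk : 0 < k)
    (ρ φ r θ : ℝ) (hρ : 0 ≤ ρ) (hφ : φ ∈ Set.Icc 0 (Real.pi / n))
    (hr : 0 ≤ r) (hθ : θ ∈ Set.Icc 0 (Real.pi / n)) :
    MeasureTheory.IntegrableOn (Dihedral.integrand n k ρ φ r θ) (Dihedral.simplex (n - 1)) ∧
    Dihedral.generalizedBessel n k
        ((ρ : ℂ) * Complex.exp ((φ : ℂ) * Complex.I))
        ((r : ℂ) * Complex.exp ((θ : ℂ) * Complex.I)) =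
      Dihedral.normConst n k /
          (n * Dihedral.beta (k + 1 / 2) (1 / 2) * Real.Gamma k ^ n) *
        ∫ u in Dihedral.simplex (n - 1), Dihedral.integrand n k ρ φ r θ u := by
  obtain ⟨m, rfl⟩ := Nat.exists_eq_add_of_le' (show 1 ≤ n by omega)
  have hm : 1 ≤ m := by omega
  refine ⟨Dihedral.integrable_integrand hm hk ρ φ r θ, ?_⟩
  have hconst : Dihedral.normConst (m + 1) k /
      ((m + 1 : ℕ) * Dihedral.beta (k + 1 / 2) (1 / 2) * Real.Gamma k ^ (m + 1))
      = Real.Gamma ((m + 1 : ℕ) * k) / Real.Gamma k ^ (m + 1) := by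
    have hβ : Dihedral.beta (k + 1 / 2) (1 / 2) ≠ 0 :=
      (ProbabilityTheory.beta_pos (by linarith) (by norm_num)).ne'
    have hnk : 0 < ((m + 1 : ℕ) : ℝ) * k := by positivity
    have hn : ((m + 1 : ℕ) : ℝ) ≠ 0 := by positivity
    have hΓ := (Real.Gamma_pos_of_pos hk).ne'
    rw [Dihedral.normConst, Real.Gamma_add_one hnk.ne']
    generalize ((m + 1 : ℕ) : ℝ) = N at hn ⊢
    generalize Dihedral.beta (k + 1 / 2) (1 / 2) = B at hβ ⊢
    generalize Real.Gamma (N * k) = G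
    field_simp
  rw [hconst]
  exact Dihedral.generalizedBessel_eq hm hk ρ φ r θ
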